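/- Let $L\ge 6$ be an even integer and let $\Lambda=(V,E)$ be the $L\times L$ grid graph with periodic boundary conditions, $V=\{0,\dots,L-1\}^2$. A site is even (odd) if the sum of its coordinates is even (odd); $V_{\mathbf e},V_{\mathbf o}$ denote the sets of even and odd sites. For $S\subseteq V$ let $\partial^+S$ be the set of sites outside $S$ adjacent to a site of $S$, and $\nabla S$ the set of edges joining $S$ to $\partial^+S$. An odd cluster is a set $C\subseteq V$ such that $\partial^+\{v\}\subseteq C$ for every odd $v\in C$, and such that $C\cap V_{\mathbf e}$ is (non-empty and) connected in the graph on $V_{\mathbf e}$ that joins two even sites at graph distance $2$ in $\Lambda$. Its perimeter $P(C)$ is the length of its contour, the set of dual edges crossing the edges of $\nabla C$, i.e. $P(C)=|\nabla C|$. A hard-core configuration is a map $\sigma:V\to\{0,1\}$ with $\sigma(v)\sigma(w)=0$ for every edge $(v,w)\in E$. Its odd region is $\mathcal O(\sigma)=\{v\in V_{\mathbf o}:\sigma(v)=1\}\cup\{v\in V_{\mathbf e}:\sigma(v)=0\}$, its real area is $\tilde n(\sigma)=|\{v\in V_{\mathbf o}:\sigma(v)=1\}|+|\{v\in V_{\mathbf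 e}:\sigma(v)=0\}|$, and its perimeter is $P(\sigma)=\sum_i P(C_i)$, where $C_1,\dots,C_m$ are the connected components of $\mathcal O(\sigma)$ (two sites being joined if they are adjacent in $\Lambda$, or are even sites at distance $2$); these are odd clusters. The real area of an odd cluster $C$ is $|C|$. For an odd site $\eta=(\eta_1,\eta_2)$ and integers $\ell_1,\ell_2\ge 1$ let $S_{\ell_1,\ell_2}(\eta)=\{(\eta_1+k+j,\eta_2+k-j):0\le k\le \ell_1-1,\ 0\le j\le \ell_2-1\}$ (coordinates modulo $L$) and let $\mathcal R_{\ell_1,\ell_2}(\eta)=S_{\ell_1,\ell_2}(\eta)\cup\partial^+S_{\ell_1,\ell_2}(\eta)$ be the odd rhombus with reference site $\eta$. Lemma (Perimeter-minimal rhombi with fixed real area). Let $1\le \ell<L/2$ and $\tilde n=2\ell^2+2\ell+1$. Then, up to the choice of the reference site, $\mathcal R_{\ell,\ell}$ is the unique perimeter minimiser of real area $\tilde n$. That is: 1. for every odd site $\eta$ the rhombus $\mathcal R_{\ell,\ell}(\eta)$ is the odd region of a hard-core configuration; 2. a hard-core configuration $\sigma$ has real area $\tilde n$ and minimal perimeter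 among all hard-core configurations of real area $\tilde n$ if and only if $\mathcal O(\sigma)=\mathcal R_{\ell,\ell}(\eta)$ for some odd site $\eta$; 3. a set $C\subseteq V$ is an odd cluster of real area $\tilde n$ with minimal perimeter among all odd clusters of real area $\tilde n$ if and only if $C=\mathcal R_{\ell,\ell}(\eta)$ for some odd site $\eta$. In particular, for $\tilde n=\frac{L^2}{2}-L+1$ the same three statements hold with the rhombi $\mathcal R_{\frac L2-1,\frac L2-1}(\eta)$. -/

import Mathlib

/-- Sites of the `L × L` grid with periodic boundary conditions; the coordinates live in
`{0, …, L - 1}` with arithmetic modulo `L`. -/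
abbrev Site (L : ℕ) : Type := ZMod L × ZMod L

/-- The `L × L` toric grid graph: the box product of two cycles on `ZMod L`. -/
def toricGrid (L : ℕ) : SimpleGraph (Site L) :=
  (SimpleGraph.circulantGraph ({1} : Set (ZMod L))).boxProd
    (SimpleGraph.circulantGraph ({1} : Set (ZMod L)))

/-- The even sites: the sum of the coordinates, taken in `{0, …, L - 1}`, is even. -/
def evenSites (L : ℕ) : Set (Site L) := {v | Even (v.1.val + v.2.val)}

/-- The odd sites: the sum of the coordinates, taken in `{0, …, L - 1}`, is odd. -/
def oddSites (L : ℕ) : Set (Site L) := {v | Odd (v.1.val + v.2.val)}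

/-- Hard-core configurations: no two neighbouring sites are both occupied. -/
def IsHardCore {L : ℕ} (σ : Site L → Fin 2) : Prop :=
  ∀ v w : Site L, (toricGrid L).Adj v w → σ v * σ w = 0

/-- The external boundary `∂⁺ S`. -/
def extBoundary {L : ℕ} (S : Set (Site L)) : Set (Site L) :=
  {v | v ∉ S ∧ ∃ w ∈ S, (toricGrid L).Adj v w}

/-- The edge boundary `∇ S`: the edges that join a site of `S` to a site of `∂⁺ S`. -/
def edgeBoundary {L : ℕ} (S : Set (Site L)) : Set (Sym2 (Site L)) :=
  {e | e ∈ (toricGrid L).edgeSet ∧ ∃ v ∈ S, ∃ w ∈ extBoundary S, e = s(v, w)}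

/-- The graph `(V_e, E*)`, on all sites (odd sites are isolated): two even sites are joined when
their graph distance on the torus is `2`. -/
def evenGraph (L : ℕ) : SimpleGraph (Site L) where
  Adj v w := v ∈ evenSites L ∧ w ∈ evenSites L ∧ (toricGrid L).dist v w = 2
  symm := ⟨fun _ _ h => ⟨h.2.1, h.1, by rw [SimpleGraph.dist_comm]; exact h.2.2⟩⟩
  loopless := ⟨fun _ h => by simpa using h.2.2⟩

/-- Odd clusters: every odd site of `C` has its four neighbours in `C`, and the even sites of `C`
are connected in `(V_e, E*)`. -/
def IsOddCluster {L : ℕ} (C : Set (Site L)) : Prop :=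
  (∀ v ∈ C, v ∈ oddSites L → extBoundary {v} ⊆ C) ∧
    ((evenGraph L).induce (C ∩ evenSites L)).Connected

/-- The perimeter of a cluster: the number of dual edges in its contour. The contour consists of
the dual edges that cross the edges of `∇ C`, one for each, so its length is the number of
edges of `∇ C`. -/
noncomputable def clusterPerimeter {L : ℕ} (C : Set (Site L)) : ℕ := (edgeBoundary C).ncard

/-- The odd region of `σ`: the occupied odd sites together with the empty even sites. -/
def oddRegion {L : ℕ} (σ : Site L → Fin 2) : Set (Site L) :=
  {v | v ∈ oddSites L ∧ σ v = 1} ∪ {v | v ∈ evenSites L ∧ σ v = 0}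

/-- The partition of the odd region of `σ` into its connected components, where sites are joined
when they are neighbours on the torus or are even sites at distance `2`. For a hard-core
configuration these components are odd clusters, see `isOddCluster_of_mem_oddClusters`. -/
def oddClusters {L : ℕ} (σ : Site L → Fin 2) : Set (Set (Site L)) :=
  {C | ∃ c : ((toricGrid L ⊔ evenGraph L).induce (oddRegion σ)).ConnectedComponent,
    C = Subtype.val '' c.supp}

/-- On an even torus neighbouring sites have different parities. -/
theorem parity_of_adj {L : ℕ} (hL : Even L) (hL0 : L ≠ 0) {v w : Site L}
    (h : (toricGrid L).Adj v w) : v ∈ oddSites L ↔ w ∈ evenSites L := by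
  have : NeZero L := ⟨hL0⟩
  have hd : 2 ∣ L := even_iff_two_dvd.mp hL
  let f := ZMod.castHom hd (ZMod 2)
  have hval : ∀ a : ZMod L, ((a.val : ℕ) : ZMod 2) = f a := fun a => by
    rw [← map_natCast f, ZMod.natCast_zmod_val]
  have he : ∀ u : Site L, u ∈ evenSites L ↔ f u.1 + f u.2 = 0 := fun u => by
    simp only [evenSites, Set.mem_ofPred_eq]
    rw [← ZMod.natCast_eq_zero_iff_even, Nat.cast_add, hval, hval]
  have ho : v ∈ oddSites L ↔ ¬ v ∈ evenSites L := by
    simp only [evenSites, oddSites, Set.mem_ofPred_eq, Nat.not_even_iff_odd]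
  have key : ∀ a b : ZMod 2, ¬ (a = b) ↔ a - b = 1 := by decide
  have hf : ∀ a b : ZMod L, (SimpleGraph.circulantGraph ({1} : Set (ZMod L))).Adj a b →
      f a = f b + 1 := by
    intro a b hab
    simp only [SimpleGraph.circulantGraph, SimpleGraph.fromRel_adj, Set.mem_singleton_iff] at hab
    have k2 : ∀ x y : ZMod 2, y = x + 1 → x = y + 1 := by decide
    rcases hab.2 with h1 | h1
    · rw [sub_eq_iff_eq_add.mp h1, map_add, map_one, add_comm]
    · apply k2
      rw [sub_eq_iff_eq_add.mp h1, map_add, map_one, add_comm]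
  rw [ho, he, he]
  have k3 : ∀ x y z : ZMod 2, ¬ (x + 1 + z = 0) ↔ x + z = 0 := by decide
  have k4 : ∀ x y z : ZMod 2, ¬ (z + (x + 1) = 0) ↔ z + x = 0 := by decide
  rw [toricGrid, SimpleGraph.boxProd_adj] at h
  rcases h with ⟨h1, h2⟩ | ⟨h1, h2⟩
  · rw [hf _ _ h1, h2]; exact k3 _ 0 _
  · rw [hf _ _ h1, h2]; exact k4 _ 0 _

theorem mem_oddSites_iff {L : ℕ} (v : Site L) : v ∈ oddSites L ↔ v ∉ evenSites L := by
  simp only [evenSites, oddSites, Set.mem_ofPred_eq, Nat.not_even_iff_odd]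

theorem dist_eq_two {L : ℕ} (hL : Even L) (hL0 : L ≠ 0) {v p q : Site L} (hp : p ∈ evenSites L)
    (hq : q ∈ evenSites L) (hvp : (toricGrid L).Adj v p) (hvq : (toricGrid L).Adj v q)
    (hne : p ≠ q) : (toricGrid L).dist p q = 2 := by
  have hle := SimpleGraph.dist_le (SimpleGraph.Walk.cons hvp.symm (SimpleGraph.Walk.cons hvq .nil))
  have h0 := (SimpleGraph.Walk.reachable
    (SimpleGraph.Walk.cons hvp.symm (SimpleGraph.Walk.cons hvq .nil))).pos_dist_of_ne hne
  have h1 : (toricGrid L).dist p q ≠ 1 := by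
    intro h
    rw [SimpleGraph.dist_eq_one_iff_adj] at h
    exact (mem_oddSites_iff p).mp ((parity_of_adj hL hL0 h).mpr hq) hp
  simp at hle
  omega

/-- The connected components of the odd region of a hard-core configuration are odd clusters. -/
theorem isOddCluster_of_mem_oddClusters {L : ℕ} (hL : Even L) (hL6 : 6 ≤ L)
    {σ : Site L → Fin 2} (hσ : IsHardCore σ) {C : Set (Site L)} (hC : C ∈ oddClusters σ) :
    IsOddCluster C := by
  have hL0 : L ≠ 0 := by omega
  obtain ⟨c, rfl⟩ := hC
  have hpar := fun {v w : Site L} => parity_of_adj (v := v) (w := w) hL hL0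
  have hoe := mem_oddSites_iff (L := L)
  have hin : ∀ v ∈ oddRegion σ, v ∈ oddSites L → ∀ w, (toricGrid L).Adj v w →
      w ∈ oddRegion σ := by
    intro v hv hvo w hw
    have h1 : σ v = 1 := by
      rcases hv with h | h
      · exact h.2
      · exact absurd h.1 ((hoe v).mp hvo)
    have h2 := hσ v w hw
    rw [h1, one_mul] at h2
    exact Or.inr ⟨(hpar hw).mp hvo, h2⟩
  have hstep : ∀ x y : oddRegion σ, x ∈ c.supp → (toricGrid L ⊔ evenGraph L).Adj x.1 y.1 →
      y ∈ c.supp := by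
    intro x y hx hxy
    rw [SimpleGraph.ConnectedComponent.mem_supp_iff] at hx ⊢
    rw [← hx]
    exact SimpleGraph.ConnectedComponent.sound
      (SimpleGraph.Adj.reachable (G := (toricGrid L ⊔ evenGraph L).induce (oddRegion σ)) hxy).symm
  have hclosed : ∀ v ∈ Subtype.val '' c.supp, v ∈ oddSites L → ∀ w, (toricGrid L).Adj v w →
      w ∈ Subtype.val '' c.supp := by
    rintro _ ⟨v, hv, rfl⟩ hvo w hw
    exact ⟨⟨w, hin v.1 v.2 hvo w hw⟩, hstep v _ hv (Or.inl hw), rfl⟩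
  refine ⟨?_, ?_⟩
  · rintro v hv hvo w ⟨-, u, hu, hwu⟩
    rw [Set.mem_singleton_iff] at hu
    subst hu
    exact hclosed u hv hvo w hwu.symm
  · set D : Set (Site L) := Subtype.val '' c.supp ∩ evenSites L with hD
    have hnear : ∀ (x : Site L) (p q : D), (p.1 = x ∨ (toricGrid L).Adj x p.1) →
        (q.1 = x ∨ (toricGrid L).Adj x q.1) → ((evenGraph L).induce D).Reachable p q := by
      intro x p q hp hq
      by_cases hpq : p = q
      · rw [hpq]
      have hne : p.1 ≠ q.1 := fun h => hpq (Subtype.ext h)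
      rcases hp with hp | hp
      · rcases hq with hq | hq
        · exact absurd (hp.trans hq.symm) hne
        · exact absurd (hp ▸ p.2.2) ((hoe x).mp ((hpar hq).mpr q.2.2))
      · rcases hq with hq | hq
        · exact absurd (hq ▸ q.2.2) ((hoe x).mp ((hpar hp).mpr p.2.2))
        · apply SimpleGraph.Adj.reachable
          exact ⟨p.2.2, q.2.2, dist_eq_two hL hL0 p.2.2 q.2.2 hp hq hne⟩
    have hmain : ∀ (x y : oddRegion σ)
        (_ : ((toricGrid L ⊔ evenGraph L).induce (oddRegion σ)).Walk x y), x ∈ c.supp →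
        ∀ p q : D, (p.1 = x.1 ∨ (toricGrid L).Adj x.1 p.1) →
        (q.1 = y.1 ∨ (toricGrid L).Adj y.1 q.1) → ((evenGraph L).induce D).Reachable p q := by
      intro x y W
      induction W with
      | nil => intro _ p q hp hq; exact hnear _ p q hp hq
      | @cons x x' y h W ih =>
        intro hx p q hp hq
        have h' : (toricGrid L ⊔ evenGraph L).Adj x.1 x'.1 := h
        have hx' := hstep x x' hx h'
        by_cases hx'e : x'.1 ∈ evenSites L
        · let p' : D := ⟨x'.1, ⟨x', hx', rfl⟩, hx'e⟩
          refine SimpleGraph.Reachable.trans ?_ (ih hx' p' q (Or.inl rfl) hq)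
          rcases h' with h' | h'
          · exact hnear x.1 p p' hp (Or.inr h')
          · have hpx : p.1 = x.1 := by
              rcases hp with hp | hp
              · exact hp
              · exact absurd h'.1 ((hoe x.1).mp ((hpar hp).mpr p.2.2))
            apply SimpleGraph.Adj.reachable
            change (evenGraph L).Adj p.1 x'.1
            rw [hpx]; exact h'
        · rcases h' with h' | h'
          · have hxe : x.1 ∈ evenSites L := (hpar h'.symm).mp ((hoe _).mpr hx'e)
            have hpx : p.1 = x.1 := by
              rcases hp with hp | hp
              · exact hp
              · exact absurd hxe ((hoe x.1).mp ((hpar hp).mpr p.2.2))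
            exact ih hx' p q (Or.inr (hpx ▸ h'.symm)) hq
          · exact absurd h'.2.1 hx'e
    have hne : Nonempty D := by
      obtain ⟨x, hx⟩ := c.nonempty_supp
      by_cases hxe : x.1 ∈ evenSites L
      · exact ⟨⟨x.1, ⟨x, hx, rfl⟩, hxe⟩⟩
      · have hxo := (hoe _).mpr hxe
        have : Fact (1 < L) := ⟨by omega⟩
        have hadj : (toricGrid L).Adj x.1 (x.1.1 + 1, x.1.2) := by
          rw [toricGrid, SimpleGraph.boxProd_adj]
          left
          simp [SimpleGraph.circulantGraph, SimpleGraph.fromRel_adj]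
        exact ⟨⟨_, hclosed x.1 ⟨x, hx, rfl⟩ hxo _ hadj, (hpar hadj).mp hxo⟩⟩
    refine (SimpleGraph.connected_iff _).mpr ⟨?_, hne⟩
    intro p q
    obtain ⟨⟨x, hx, hxp⟩, -⟩ := p.2
    obtain ⟨⟨y, hy, hyq⟩, -⟩ := q.2
    obtain ⟨W⟩ := c.reachable_of_mem_supp hx hy
    exact hmain x y W hx p q (Or.inl hxp.symm) (Or.inl hyq.symm)

/-- The perimeter of a configuration: the sum of the perimeters of its odd clusters. -/
noncomputable def perimeter {L : ℕ} (σ : Site L → Fin 2) : ℕ :=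
  ∑ᶠ C ∈ oddClusters σ, clusterPerimeter C

/-- The real area of `σ`: the number of occupied odd sites plus the number of empty even sites. -/
noncomputable def realArea {L : ℕ} (σ : Site L → Fin 2) : ℕ :=
  {v | v ∈ oddSites L ∧ σ v = 1}.ncard + {v | v ∈ evenSites L ∧ σ v = 0}.ncard

/-- The set `S_{ℓ₁,ℓ₂}(η)` of the sites `η + (k + j, k - j)`, `0 ≤ k ≤ ℓ₁ - 1`,
`0 ≤ j ≤ ℓ₂ - 1`. -/
def rhombusOddSites {L : ℕ} (l₁ l₂ : ℕ) (η : Site L) : Set (Site L) :=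
  {v | ∃ k j : ℕ, k < l₁ ∧ j < l₂ ∧
    v = (η.1 + (k : ZMod L) + (j : ZMod L), η.2 + (k : ZMod L) - (j : ZMod L))}

/-- The (non-degenerate) odd rhombus `R_{ℓ₁,ℓ₂}(η)` with lengths `ℓ₁, ℓ₂ ≥ 1` and an odd reference
site `η`. -/
def rhombus {L : ℕ} (l₁ l₂ : ℕ) (η : Site L) : Set (Site L) :=
  rhombusOddSites l₁ l₂ η ∪ extBoundary (rhombusOddSites l₁ l₂ η)

/-- `σ` is a hard-core configuration of real area `n` whose perimeter is minimal among the
hard-core configurations of real area `n`. -/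
def IsPerimeterMinimal {L : ℕ} (n : ℕ) (σ : Site L → Fin 2) : Prop :=
  IsHardCore σ ∧ realArea σ = n ∧
    ∀ τ : Site L → Fin 2, IsHardCore τ → realArea τ = n → perimeter σ ≤ perimeter τ

/-- `C` is an odd cluster with `n` sites whose perimeter is minimal among the odd clusters with
`n` sites. -/
def IsPerimeterMinimalCluster {L : ℕ} (n : ℕ) (C : Set (Site L)) : Prop :=
  IsOddCluster C ∧ C.ncard = n ∧
    ∀ D : Set (Site L), IsOddCluster D → D.ncard = n → clusterPerimeter C ≤ clusterPerimeter D

/-- The rhombi `R_{ℓ,ℓ}`, up to the choice of the odd reference site, are the unique perimeter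
minimisers of real area `n`: each of them is the odd region of a hard-core configuration; the
configurations of minimal perimeter at real area `n` are exactly those whose odd region is such a
rhombus; and the odd clusters of minimal perimeter at real area `n` are exactly these rhombi. -/
def RhombusIsUniqueMinimizer (L l n : ℕ) : Prop :=
  (∀ η ∈ oddSites L, ∃ σ : Site L → Fin 2, IsHardCore σ ∧ oddRegion σ = rhombus l l η) ∧
  (∀ σ : Site L → Fin 2, IsHardCore σ →
    (IsPerimeterMinimal n σ ↔ ∃ η ∈ oddSites L, oddRegion σ = rhombus l l η)) ∧
  (∀ C : Set (Site L),
    IsPerimeterMinimalCluster n C ↔ ∃ η ∈ oddSites L, C = rhombus l l η)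

/-!
Let `L = 2 * M`. If a set `C` of sites contains all neighbours of its odd sites, then the edges at
its even sites either lead to odd sites of `C`, where they use up all four edges, or belong to
`∇ C`; hence the perimeter is `4 * (e - o)`, with `e` and `o` the numbers of even and odd sites
(`clusterPerimeter_add`, and `IsHardCore.perimeter_add` after summing over clusters). For a fixed
area `e + o = 2 * l ^ 2 + 2 * l + 1` a minimal perimeter therefore means a maximal `o`, and since
`C` contains `∂⁺` of its odd sites the theorem amounts to a vertex-isoperimetric inequality
(`sq_le_ncard_extBoundary`): `l ^ 2` odd sites, `l < M`, have at least `(l + 1) ^ 2` neighbours,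
with equality only for the square rhombi.

Up to a translation, `∂⁺ O` is `O + {0, a} + {0, b}` in the even sublattice, where `a = (1, 1)` and
`b = (1, -1)`. This group has `M` lines in each of the two directions, all cyclic of length `2 * M`,
and a line that meets a set without lying in it gains a point under `X ↦ X ∪ (X + c)`
(`card_add_card_image_le_card_thicken`). There are three cases for `N = O + {0, a} + {0, b}`.

* `N` contains a full line. Walking from it to the line that meets `O` in the fewest points yields
  so many new points that `N` has at least `2 * M` points more than `O`
  (`IsFrame.card_add_le_of_full_line`).
* `N` contains no full line, and all lines meet `O`. Each of the `M` lines of either direction gains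
  a point, again `2 * M` in all (`IsFrame.card_add_le_of_no_empty_line`).
* `N` contains no full line, and some line misses `O`. Cutting along that line turns `O` into a
  subset of `ZMod L × ZMod L` with projections of sizes `r` and `s`, so that `r * s ≥ l ^ 2` and `N`
  has at least `r + s + 1 ≥ 2 * l + 1` points more than `O`; equality forces `r = s = l`, and `O` is
  then a product of two arcs (`sq_le_card_thicken_prod`).

As `2 * M > 2 * l + 1`, equality occurs only in the last case.
-/

/-! ### Thickenings and cyclic lines -/

/-- `X ∪ (X + c)`: the set `X` together with its translate by `c`. -/
def thicken {G : Type*} [AddCommGroup G] [DecidableEq G] (c : G) (X : Finset G) : Finset G :=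
  X ∪ X.image (· + c)

/-- A set that is closed under translation by `γ 1` contains the whole `γ`-line through each of
its points. -/
theorem line_subset_of_closed {G : Type*} [AddCommGroup G] {L : ℕ} [NeZero L]
    (γ : ZMod L →+ G) {X : Finset G} {x : G}
    (hx : x ∈ X) (hcl : ∀ n : ℕ, x + γ n ∈ X → x + γ (n + 1) ∈ X) (j : ZMod L) :
    x + γ j ∈ X := by
  have h : ∀ n : ℕ, x + γ (n : ZMod L) ∈ X := by
    intro n
    induction n with
    | zero => simpa using hx
    | succ n ih => simpa using hcl n ih
  simpa using h j.val

section Thicken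

variable {G : Type*} [AddCommGroup G] [DecidableEq G]

theorem mem_thicken {c g : G} {X : Finset G} : g ∈ thicken c X ↔ g ∈ X ∨ g - c ∈ X := by
  simp only [thicken, Finset.mem_union, Finset.mem_image]
  refine or_congr Iff.rfl ⟨?_, fun h => ⟨_, h, by abel⟩⟩
  rintro ⟨x, hx, rfl⟩
  simpa using hx

theorem subset_thicken (c : G) (X : Finset G) : X ⊆ thicken c X := Finset.subset_union_left

theorem add_mem_thicken {c x : G} {X : Finset G} (hx : x ∈ X) : x + c ∈ thicken c X :=
  mem_thicken.2 (Or.inr (by simpa using hx))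

theorem thicken_comm (c d : G) (X : Finset G) :
    thicken c (thicken d X) = thicken d (thicken c X) := by
  ext g
  simp only [mem_thicken, sub_right_comm g c d]
  tauto

/-- Every `γ`-line that meets `X` without lying in `X` contributes a new point to
`thicken (γ 1) X`. The lines are counted through a map `f` that is constant on each of them. -/
theorem card_add_card_image_le_card_thicken {L : ℕ} [NeZero L] {ι : Type*} [DecidableEq ι]
    (γ : ZMod L →+ G) (f : G → ι) (hf : ∀ g, f (g + γ 1) = f g) (X : Finset G)
    (hX : ∀ g, ∃ j, g + γ j ∉ X) :
    X.card + (X.image f).card ≤ (thicken (γ 1) X).card := by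
  have hsub : X.image f ⊆ (thicken (γ 1) X \ X).image f := by
    intro i hi
    obtain ⟨x, hx, rfl⟩ := Finset.mem_image.1 hi
    by_contra hno
    obtain ⟨j, hj⟩ := hX x
    apply hj
    have hfn : ∀ n : ℕ, f (x + γ n) = f x := by
      intro n
      induction n with
      | zero => simp
      | succ n ih => rw [← ih, ← hf (x + γ n)]; simp [add_assoc]
    refine line_subset_of_closed γ hx (fun n hn => ?_) j
    by_contra hn'
    apply hno
    refine Finset.mem_image.2 ⟨x + γ (n + 1), Finset.mem_sdiff.2 ⟨?_, hn'⟩, ?_⟩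
    · rw [map_add, ← add_assoc]
      exact add_mem_thicken hn
    · exact_mod_cast hfn (n + 1)
  have h1 := Finset.card_le_card hsub
  have h2 := Finset.card_image_le (s := thicken (γ 1) X \ X) (f := f)
  have h3 := Finset.card_sdiff_add_card_eq_card (subset_thicken (γ 1) X)
  omega

end Thicken

section Cyclic

variable {L : ℕ} [NeZero L]

theorem card_lt_card_thicken_one {X : Finset (ZMod L)} (hne : X.Nonempty)
    (hX : X ≠ Finset.univ) : X.card + 1 ≤ (thicken 1 X).card := by
  have h := card_add_card_image_le_card_thicken (AddMonoidHom.id (ZMod L)) (fun _ => ())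
    (fun _ => rfl) X (by
      intro g
      obtain ⟨j, hj⟩ : ∃ j, j ∉ X := by
        by_contra! hall
        exact hX (Finset.eq_univ_of_forall hall)
      exact ⟨j - g, by simpa using hj⟩)
  have h1 : (X.image (fun _ => ())).card = 1 := by
    rw [Finset.image_const hne]; rfl
  rw [h1] at h
  exact h

/-- A set of residues that grows by a single point under `thicken 1` is an arc. -/
theorem exists_arc_of_card_thicken_one {X : Finset (ZMod L)}
    (hX : (thicken 1 X).card = X.card + 1) :
    ∃ x : ZMod L, ∀ y, y ∈ X ↔ ∃ i : ℕ, i < X.card ∧ y = x + i := by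
  have hcard : (thicken 1 X \ X).card = 1 := by
    have := Finset.card_sdiff_add_card_eq_card (subset_thicken 1 X)
    omega
  obtain ⟨e, he⟩ := Finset.card_eq_one.1 hcard
  have heX : e ∉ X := by
    have : e ∈ thicken 1 X \ X := by simp [he]
    exact (Finset.mem_sdiff.1 this).2
  have hstep : ∀ x ∈ X, x + 1 ≠ e → x + 1 ∈ X := by
    intro x hx hxe
    by_contra h
    have : x + 1 ∈ thicken 1 X \ X := Finset.mem_sdiff.2 ⟨add_mem_thicken hx, h⟩
    rw [he, Finset.mem_singleton] at this
    exact hxe this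
  -- `m` is the length of the arc of `X` that ends just before `e`
  have hex : ∃ m : ℕ, e - 1 - (m : ZMod L) ∉ X :=
    ⟨(-1 : ZMod L).val, by simpa using heX⟩
  classical
  set m := Nat.find hex with hm
  have hmX : e - 1 - (m : ZMod L) ∉ X := Nat.find_spec hex
  have hlt : ∀ i < m, e - 1 - (i : ZMod L) ∈ X := fun i hi => by
    simpa using Nat.find_min hex hi
  have hmem : ∀ y ∈ X, ∃ i < m, y = e - 1 - (i : ZMod L) := by
    intro y hy
    by_contra hno
    -- the points of `X` outside that arc are closed under `+ 1`
    have key := line_subset_of_closed (AddMonoidHom.id (ZMod L))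
      (X := X.filter (fun y => ¬ ∃ i < m, y = e - 1 - (i : ZMod L))) (x := y)
      (Finset.mem_filter.2 ⟨hy, hno⟩) (by
        intro n hn
        simp only [AddMonoidHom.id_apply, Finset.mem_filter] at hn ⊢
        obtain ⟨h1, h2⟩ := hn
        rw [← add_assoc]
        have hm0 : 0 < m := by
          rcases Nat.eq_zero_or_pos m with h0 | h0
          · exfalso
            obtain ⟨x, hx⟩ : ∃ x, x ∈ thicken 1 X \ X := ⟨e, by simp [he]⟩
            have hxe : x = e := by simpa [he] using hx
            rw [hxe, Finset.mem_sdiff, mem_thicken] at hx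
            rw [h0] at hmX
            rcases hx.1 with h | h
            · exact heX h
            · exact hmX (by simpa using h)
          · exact h0
        refine ⟨hstep _ h1 ?_, ?_⟩
        · intro h
          exact h2 ⟨0, hm0, by rw [← h]; simp⟩
        · rintro ⟨i, hi, hie⟩
          have hie' : y + n = e - 1 - ((i + 1 : ℕ) : ZMod L) := by
            rw [Nat.cast_add, Nat.cast_one, ← sub_sub, ← hie]; ring
          rcases Nat.lt_or_ge (i + 1) m with h | h
          · exact h2 ⟨i + 1, h, hie'⟩
          · have : i + 1 = m := by omega
            rw [this] at hie'
            exact hmX (hie' ▸ h1)) (e - y)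
    have := (Finset.mem_filter.1 key).1
    simp at this
    exact heX this
  have hmL : m ≤ L := by
    by_contra! h
    have := hlt ((-1 : ZMod L).val) (lt_trans (ZMod.val_lt _) h)
    exact heX (by simpa using this)
  have hXm : X = (Finset.range m).image (fun i : ℕ => e - 1 - (i : ZMod L)) := by
    ext y
    simp only [Finset.mem_image, Finset.mem_range]
    constructor
    · intro hy
      obtain ⟨i, hi, h⟩ := hmem y hy
      exact ⟨i, hi, h.symm⟩
    · rintro ⟨i, hi, rfl⟩
      exact hlt i hi
  have hXc : X.card = m := by
    conv_lhs => rw [hXm]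
    rw [Finset.card_image_of_injOn, Finset.card_range]
    intro i hi j hj hij
    simp only [Finset.coe_range, Set.mem_Iio] at hi hj
    have := sub_right_injective hij
    have h2 := congrArg ZMod.val this
    rwa [ZMod.val_natCast_of_lt (by omega), ZMod.val_natCast_of_lt (by omega)] at h2
  refine ⟨e - m, fun y => ?_⟩
  rw [hXc]
  constructor
  · intro hy
    obtain ⟨i, hi, rfl⟩ := hmem y hy
    refine ⟨m - 1 - i, by omega, ?_⟩
    have : (m : ZMod L) = ((m - 1 - i : ℕ) : ZMod L) + i + 1 := by
      rw [← Nat.cast_add, ← Nat.cast_succ]; congr 1; omega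
    rw [this]; ring
  · rintro ⟨i, hi, rfl⟩
    have h := hlt (m - 1 - i) (by omega)
    have : (m : ZMod L) = ((m - 1 - i : ℕ) : ZMod L) + i + 1 := by
      rw [← Nat.cast_add, ← Nat.cast_succ]; congr 1; omega
    convert h using 1
    rw [this]; ring

end Cyclic

/-! ### The product of two cycles, and frames -/

theorem thicken_product {L : ℕ} (A B : Finset (ZMod L)) :
    thicken ((0 : ZMod L), (1 : ZMod L)) (thicken (1, 0) (A ×ˢ B)) =
      thicken 1 A ×ˢ thicken 1 B := by
  ext ⟨a, b⟩
  simp only [mem_thicken, Finset.mem_product, Prod.mk_sub_mk, sub_zero]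
  tauto

section Product

variable {L : ℕ} [NeZero L]

/-- The vertex-isoperimetric inequality on the discrete torus `ZMod L × ZMod L` for sets whose
thickening contains no full row and no full column. -/
theorem card_add_card_le_card_thicken_prod {X : Finset (ZMod L × ZMod L)}
    (hrow : ∀ j, ∃ k, (k, j) ∉ thicken (0, 1) (thicken (1, 0) X))
    (hcol : ∀ k, ∃ j, (k, j) ∉ thicken (0, 1) (thicken (1, 0) X)) :
    X.card + (X.image Prod.snd).card + (thicken 1 (X.image Prod.fst)).card ≤
      (thicken (0, 1) (thicken (1, 0) X)).card := by
  have h1 := card_add_card_image_le_card_thicken (AddMonoidHom.inl (ZMod L) (ZMod L)) Prod.snd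
    (fun g => by simp) X (by
      rintro ⟨a, b⟩
      obtain ⟨k, hk⟩ := hrow b
      refine ⟨k - a, fun h => hk (subset_thicken _ _ (subset_thicken _ _ ?_))⟩
      simpa using h)
  have h2 := card_add_card_image_le_card_thicken (AddMonoidHom.inr (ZMod L) (ZMod L)) Prod.fst
    (fun g => by simp) (thicken (1, 0) X) (by
      rintro ⟨a, b⟩
      obtain ⟨j, hj⟩ := hcol a
      refine ⟨j - b, fun h => hj (subset_thicken _ _ ?_)⟩
      simpa using h)
  have h3 : (thicken (1, 0) X).image Prod.fst = thicken 1 (X.image Prod.fst) := by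
    simp only [thicken, Finset.image_union, Finset.image_image]
    rfl
  rw [h3] at h2
  simp only [AddMonoidHom.inl_apply, AddMonoidHom.inr_apply] at h1 h2
  omega

/-- A set of `l ^ 2` points with the smallest thickening is a product of two arcs: both
projections have `l` points by the inequality between the means, so the set is their product,
and each of them grows by a single point. -/
theorem sq_le_card_thicken_prod {l : ℕ} (hl : 1 ≤ l) {X : Finset (ZMod L × ZMod L)}
    (hX : X.card = l ^ 2)
    (hrow : ∀ j, ∃ k, (k, j) ∉ thicken (0, 1) (thicken (1, 0) X))
    (hcol : ∀ k, ∃ j, (k, j) ∉ thicken (0, 1) (thicken (1, 0) X))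
    (h1 : X.image Prod.fst ≠ Finset.univ) :
    l ^ 2 + 2 * l + 1 ≤ (thicken (0, 1) (thicken (1, 0) X)).card ∧
    ((thicken (0, 1) (thicken (1, 0) X)).card = l ^ 2 + 2 * l + 1 →
      ∃ x y : ZMod L, ∀ p, p ∈ X ↔ ∃ i j : ℕ, i < l ∧ j < l ∧ p = (x + i, y + j)) := by
  have hne : X.Nonempty := by
    rw [← Finset.card_pos, hX]; positivity
  have hsub : X ⊆ X.image Prod.fst ×ˢ X.image Prod.snd := fun p hp =>
    Finset.mem_product.2 ⟨Finset.mem_image_of_mem _ hp, Finset.mem_image_of_mem _ hp⟩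
  have key := card_add_card_le_card_thicken_prod hrow hcol
  have hgrow := card_lt_card_thicken_one (hne.image Prod.fst) h1
  have hprod := Finset.card_le_card hsub
  rw [Finset.card_product, hX] at hprod
  rw [hX] at key
  set A := X.image Prod.fst with hA
  set B := X.image Prod.snd with hB
  set N := thicken (0, 1) (thicken (1, 0) X) with hN
  have hsum : 2 * l ≤ A.card + B.card := by
    by_contra! h
    nlinarith [sq_nonneg ((A.card : ℤ) - B.card)]
  have heq : A.card + B.card = 2 * l → A.card = l ∧ B.card = l := by
    intro h
    have h2 : (A.card : ℤ) = l := by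
      have h3 : (B.card : ℤ) = 2 * l - A.card := by omega
      have h4 : (l : ℤ) ^ 2 ≤ A.card * B.card := by exact_mod_cast hprod
      rw [h3] at h4
      have : ((A.card : ℤ) - l) ^ 2 = 0 := le_antisymm (by nlinarith) (sq_nonneg _)
      have := pow_eq_zero_iff (two_ne_zero) |>.1 this
      omega
    omega
  refine ⟨by omega, fun h => ?_⟩
  obtain ⟨hAl, hBl⟩ := heq (by omega)
  have hXAB : X = A ×ˢ B := Finset.eq_of_subset_of_card_le hsub
    (by rw [Finset.card_product, hAl, hBl, hX, sq])
  have hAt : (thicken 1 A).card = A.card + 1 := by omega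
  have hBt : (thicken 1 B).card = B.card + 1 := by
    have h5 : N.card = (thicken 1 A).card * (thicken 1 B).card := by
      rw [← Finset.card_product, ← thicken_product, ← hXAB]
    rw [h, hAt, hAl] at h5
    rw [hBl]
    have : (l + 1) * (l + 1) = (l + 1) * (thicken 1 B).card := by rw [← h5]; ring
    exact (Nat.eq_of_mul_eq_mul_left (Nat.succ_pos l) this).symm
  obtain ⟨x, hx⟩ := exists_arc_of_card_thicken_one hAt
  obtain ⟨y, hy⟩ := exists_arc_of_card_thicken_one hBt
  refine ⟨x, y, ?_⟩
  rintro ⟨a, b⟩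
  rw [hXAB, Finset.mem_product, hx, hy, hAl, hBl]
  constructor
  · rintro ⟨⟨i, hi, h1⟩, ⟨j, hj, h2⟩⟩
    exact ⟨i, j, hi, hj, Prod.ext h1 h2⟩
  · rintro ⟨i, j, hi, hj, h3⟩
    exact ⟨⟨i, hi, congrArg Prod.fst h3⟩, ⟨j, hj, congrArg Prod.snd h3⟩⟩

end Product

/-- `α` and `β` frame the group `G` if the `β`-lines through `α k`, `0 ≤ k < M`, partition `G`:
each element is `α k + β j` for exactly one `k` with representative below `M` and exactly
one `j`. -/
def IsFrame {L : ℕ} {G : Type*} [AddCommGroup G] (M : ℕ) (α β : ZMod L →+ G) : Prop :=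
  ∀ g, ∃! q : ZMod L × ZMod L, q.1.val < M ∧ α q.1 + β q.2 = g

theorem IsFrame.exists_eq {L M : ℕ} {G : Type*} [AddCommGroup G] {α β : ZMod L →+ G}
    (hF : IsFrame M α β) (p g : G) :
    ∃ q : ZMod L × ZMod L, q.1.val < M ∧ p + α q.1 + β q.2 = g := by
  obtain ⟨q, ⟨h1, h2⟩, -⟩ := hF (g - p)
  exact ⟨q, h1, by rw [add_assoc, h2]; abel⟩

theorem IsFrame.eq_of_eq {L M : ℕ} {G : Type*} [AddCommGroup G] {α β : ZMod L →+ G}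
    (hF : IsFrame M α β) (p : G) {q r : ZMod L × ZMod L}
    (hq : q.1.val < M) (hr : r.1.val < M)
    (h : p + α q.1 + β q.2 = p + α r.1 + β r.2) : q = r :=
  (hF (α r.1 + β r.2)).unique ⟨hq, by simpa [add_assoc] using h⟩ ⟨hr, rfl⟩

section Frame

variable {L M : ℕ} [NeZero L] {G : Type*} [AddCommGroup G] [DecidableEq G]
  {α β : ZMod L →+ G}

/-- The coordinates, in the frame `α`, `β` with origin `p`, of the points of `X`. -/
def coords (M : ℕ) (α β : ZMod L →+ G) (p : G) (X : Finset G) : Finset (ZMod L × ZMod L) :=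
  Finset.univ.filter (fun q => q.1.val < M ∧ p + α q.1 + β q.2 ∈ X)

theorem mem_coords {p : G} {X : Finset G} {q : ZMod L × ZMod L} :
    q ∈ coords M α β p X ↔ q.1.val < M ∧ p + α q.1 + β q.2 ∈ X := by
  simp [coords]

theorem IsFrame.card_coords (hF : IsFrame M α β) (p : G) (X : Finset G) :
    (coords M α β p X).card = X.card := by
  refine Finset.card_bij (fun q _ => p + α q.1 + β q.2) (fun q hq => (mem_coords.1 hq).2)
    (fun q hq r hr h => hF.eq_of_eq p (mem_coords.1 hq).1 (mem_coords.1 hr).1 h) ?_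
  intro g hg
  obtain ⟨q, hq, rfl⟩ := hF.exists_eq p g
  exact ⟨q, mem_coords.2 ⟨hq, hg⟩, rfl⟩

/-- The points of the `β`-line through `g` that lie in `X`, as residues. -/
def lineSection (β : ZMod L →+ G) (g : G) (X : Finset G) : Finset (ZMod L) :=
  Finset.univ.filter (fun j => g + β j ∈ X)

theorem mem_lineSection {g : G} {X : Finset G} {j : ZMod L} :
    j ∈ lineSection β g X ↔ g + β j ∈ X := by simp [lineSection]

theorem thicken_lineSection (g : G) (X : Finset G) :
    lineSection β g (thicken (β 1) X) = thicken 1 (lineSection β g X) := by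
  ext j
  simp [mem_lineSection, mem_thicken, add_sub_assoc]

theorem IsFrame.card_eq_sum (hF : IsFrame M α β) (p : G) (X : Finset G) :
    X.card = ∑ k ∈ Finset.univ.filter (fun k : ZMod L => k.val < M),
      (lineSection β (p + α k) X).card := by
  rw [← hF.card_coords p X, coords, Finset.card_filter, ← Finset.univ_product_univ,
    Finset.sum_product, Finset.sum_filter]
  refine Finset.sum_congr rfl fun k _ => ?_
  split_ifs with hk
  · rw [lineSection, Finset.card_filter]
    simp only [hk, true_and]
  · simp [hk]

theorem card_filter_val_lt (h : M ≤ L) :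
    (Finset.univ.filter (fun k : ZMod L => k.val < M)).card = M := by
  conv_rhs => rw [← Finset.card_range M]
  refine Finset.card_bij (fun k _ => k.val) (by simp) (fun _ _ _ _ h => ZMod.val_injective L h) ?_
  intro n hn
  have hn' := Finset.mem_range.1 hn
  have hv := ZMod.val_natCast_of_lt (lt_of_lt_of_le hn' h)
  exact ⟨n, by simp [hv, hn'], hv⟩

/-- If `thicken (α 1) Y` contains a full `β`-line, then on the way from that line to the line
through `g` each point of the latter outside `Y` accounts for an exit from `Y`. -/
theorem IsFrame.card_le_card_thicken_of_full_line (hL : L = 2 * M) (hM : 1 ≤ M)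
    (hF : IsFrame M α β) {Y : Finset G} {g₀ : G}
    (hfull : ∀ j, g₀ + β j ∈ thicken (α 1) Y) (g : G) :
    Y.card + 2 * M ≤ (thicken (α 1) Y).card + (lineSection β g Y).card := by
  set N := thicken (α 1) Y with hN
  -- the origin is such that the line through `g` is the last one
  set p := g - α ((M - 1 : ℕ) : ZMod L) with hp
  have hexit : (lineSection β g Y)ᶜ ⊆ (coords M α β p (N \ Y)).image Prod.snd := by
    intro j hj
    rw [Finset.mem_compl, mem_lineSection] at hj
    by_contra hno
    have hno' : ∀ n : ℕ, n < M → p + α (n : ZMod L) + β j ∈ N → p + α (n : ZMod L) + β j ∈ Y := by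
      intro n hn hnN
      by_contra hnY
      refine hno (Finset.mem_image.2 ⟨((n : ZMod L), j), mem_coords.2 ⟨?_, ?_⟩, rfl⟩)
      · rw [ZMod.val_natCast_of_lt (by omega)]; exact hn
      · exact Finset.mem_sdiff.2 ⟨hnN, hnY⟩
    obtain ⟨⟨k, i⟩, hk, hki⟩ := hF.exists_eq p g₀
    have hall : ∀ n : ℕ, k.val + n < M → p + α ((k.val + n : ℕ) : ZMod L) + β j ∈ Y := by
      intro n
      induction n with
      | zero =>
        intro h
        refine hno' _ h ?_
        have := hfull (j - i)
        rw [← hki] at this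
        simpa using this
      | succ n ih =>
        intro h
        refine hno' _ h ?_
        have := add_mem_thicken (c := α 1) (ih (by omega))
        convert this using 1
        push_cast
        simp only [map_add]
        abel
    have h := hall (M - 1 - k.val) (by simp only at hk; omega)
    apply hj
    convert h using 2
    have : k.val + (M - 1 - k.val) = M - 1 := by simp only at hk; omega
    rw [this, hp]; abel
  have h1 := (Finset.card_le_card hexit).trans Finset.card_image_le
  rw [hF.card_coords, Finset.card_compl, ZMod.card] at h1
  have h2 := Finset.card_sdiff_add_card_eq_card (subset_thicken (α 1) Y)
  rw [← hN] at h2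
  omega

end Frame

/-! ### The isoperimetric inequality in a framed group -/

section Isoperimetry

variable {L M : ℕ} [NeZero L] {G : Type*} [AddCommGroup G] [DecidableEq G]
  {α β : ZMod L →+ G}

/-- A set of at most `(M - 1) ^ 2` points whose thickening contains a full `β`-line gains at
least `2 * M` points. The bound is obtained by walking from the full line to the line that meets
the set in the fewest points, say `m`: the exits on the way make up for the points missing from
that line, so it remains to show that the other lines together gain at least `m` points
along `β`. -/
theorem IsFrame.card_add_le_of_full_line [Finite G] (hL : L = 2 * M) (hM : 1 ≤ M)
    (hF : IsFrame M α β) {X : Finset G} (hX : X.card ≤ (M - 1) ^ 2) {g₀ : G}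
    (hfull : ∀ j, g₀ + β j ∈ thicken (α 1) (thicken (β 1) X)) :
    X.card + 2 * M ≤ (thicken (α 1) (thicken (β 1) X)).card := by
  obtain ⟨g, hg⟩ := Finite.exists_min (fun g : G => (lineSection β g X).card)
  set Y := thicken (β 1) X with hY
  have hwalk := hF.card_le_card_thicken_of_full_line hL hM hfull g
  set m := (lineSection β g X).card with hm
  set p := g - α ((M - 1 : ℕ) : ZMod L) with hp
  set I := Finset.univ.filter (fun k : ZMod L => k.val < M) with hI
  have hlast : ((M - 1 : ℕ) : ZMod L) ∈ I := by
    rw [hI, Finset.mem_filter, ZMod.val_natCast_of_lt (by omega)]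
    exact ⟨Finset.mem_univ _, by omega⟩
  have hpg : p + α ((M - 1 : ℕ) : ZMod L) = g := by rw [hp]; abel
  have hXs := hF.card_eq_sum p X
  have hYs := hF.card_eq_sum p Y
  rw [← hI, ← Finset.sum_erase_add _ _ hlast, hpg] at hXs hYs
  set J := I.erase ((M - 1 : ℕ) : ZMod L) with hJ
  have hJc : J.card = M - 1 := by
    rw [hJ, Finset.card_erase_of_mem hlast, hI, card_filter_val_lt (by omega)]
  have hmono : ∀ h : G, (lineSection β h X).card ≤ (lineSection β h Y).card := fun h => by
    rw [hY, thicken_lineSection]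
    exact Finset.card_le_card (subset_thicken _ _)
  have hle := Finset.sum_le_sum (s := J) (fun k _ => hmono (p + α k))
  set SX := ∑ k ∈ J, (lineSection β (p + α k) X).card with hSX
  set SY := ∑ k ∈ J, (lineSection β (p + α k) Y).card with hSY
  suffices hgain : SX + m ≤ SY by omega
  rcases Nat.eq_zero_or_pos m with h0 | h0
  · omega
  have hmL : ∀ h : G, (lineSection β h X).card ≤ 2 * M := fun h => by
    refine (Finset.card_le_univ _).trans ?_
    rw [ZMod.card, hL]
  have hm2 : m ≤ 2 * M := hmL g
  -- a line either gains a point or is full; weighting the gain by `2 * M - m` covers both cases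
  have hterm : ∀ k ∈ J, 2 * (M : ℤ) ≤ (2 * M - m) * ((lineSection β (p + α k) Y).card -
      (lineSection β (p + α k) X).card : ℤ) + (lineSection β (p + α k) X).card := by
    intro k _
    have hmin : m ≤ (lineSection β (p + α k) X).card := hg (p + α k)
    by_cases hu : lineSection β (p + α k) X = Finset.univ
    · have h1 : (lineSection β (p + α k) X).card = 2 * M := by
        rw [hu, Finset.card_univ, ZMod.card, hL]
      have h2 := hmono (p + α k)
      rw [h1] at h2 ⊢
      have : (0 : ℤ) ≤ (2 * M - m) * ((lineSection β (p + α k) Y).card - ((2 * M : ℕ) : ℤ)) :=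
        mul_nonneg (by omega) (by omega)
      push_cast at this ⊢
      linarith
    · have h1 := card_lt_card_thicken_one (Finset.card_pos.1 (by omega)) hu
      rw [← thicken_lineSection, ← hY] at h1
      have : (0 : ℤ) ≤ (2 * M - m) * ((lineSection β (p + α k) Y).card -
          (lineSection β (p + α k) X).card - 1 : ℤ) :=
        mul_nonneg (by omega) (by omega)
      have h3 : (m : ℤ) ≤ (lineSection β (p + α k) X).card := by exact_mod_cast hmin
      linarith
  have hsum := Finset.sum_le_sum hterm
  rw [Finset.sum_const, hJc, Finset.sum_add_distrib, ← Finset.mul_sum, Finset.sum_sub_distrib,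
    ← Nat.cast_sum, ← Nat.cast_sum, ← hSX, ← hSY, nsmul_eq_mul] at hsum
  have hXc : (SX : ℤ) + m ≤ (M - 1) ^ 2 := by
    have : SX + m ≤ (M - 1) ^ 2 := by omega
    zify [hM] at this
    exact this
  push_cast [Nat.cast_sub hM] at hsum
  by_contra! hlt
  have hlt' : (SY : ℤ) - SX ≤ m - 1 := by omega
  have h5 : (2 * (M : ℤ) - m) * (SY - SX) ≤ (2 * M - m) * (m - 1) :=
    mul_le_mul_of_nonneg_left hlt' (by omega)
  nlinarith [sq_nonneg ((M : ℤ) - m)]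

/-- The case in which some `β`-line misses `X`: cutting along it turns `X` into a subset of
`ZMod L × ZMod L` whose first projection is not everything. -/
theorem IsFrame.sq_le_card_of_empty_line (hL : L = 2 * M) (hM : 1 ≤ M) (hF : IsFrame M α β)
    {l : ℕ} (hl : 1 ≤ l) {X : Finset G} (hX : X.card = l ^ 2)
    (hfull : ∀ g, ∃ j, g + β j ∉ thicken (β 1) (thicken (α 1) X)) {g₀ : G}
    (hempty : ∀ j, g₀ + β j ∉ X) :
    l ^ 2 + 2 * l + 1 ≤ (thicken (β 1) (thicken (α 1) X)).card ∧
    ((thicken (β 1) (thicken (α 1) X)).card = l ^ 2 + 2 * l + 1 →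
      ∃ p, ∀ g, g ∈ X ↔ ∃ i j : ℕ, i < l ∧ j < l ∧ g = p + α i + β j) := by
  set p := g₀ - α ((M - 1 : ℕ) : ZMod L) with hp
  set Z := coords M α β p X with hZ
  have hval : ∀ q ∈ Z, q.1.val + 1 < M := by
    intro q hq
    obtain ⟨h1, h2⟩ := mem_coords.1 hq
    by_contra h
    have h3 : q.1 = ((M - 1 : ℕ) : ZMod L) := by
      rw [← ZMod.natCast_zmod_val q.1]; congr 1; omega
    apply hempty q.2
    rw [h3, hp] at h2
    simpa using h2
  have hZX : ∀ q ∈ Z, p + α q.1 + β q.2 ∈ X := fun q hq => (mem_coords.1 hq).2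
  have hstep : ∀ q ∈ thicken (1, 0) Z, q.1.val < M ∧ p + α q.1 + β q.2 ∈ thicken (α 1) X := by
    intro q hq
    rcases mem_thicken.1 hq with h | h
    · exact ⟨by have := hval q h; omega, subset_thicken _ _ (hZX q h)⟩
    · have h1 := hval _ h
      have h2 := hZX _ h
      have hq1 : q.1 = (q - (1, 0)).1 + 1 := by simp
      refine ⟨?_, mem_thicken.2 (Or.inr ?_)⟩
      · rw [hq1, ← ZMod.natCast_zmod_val (q - (1, 0) : ZMod L × ZMod L).1, ← Nat.cast_succ,
          ZMod.val_natCast_of_lt (by omega)]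
        omega
      · convert h2 using 1
        simp only [Prod.fst_sub, Prod.snd_sub, sub_zero, map_sub]
        abel
  have hstep2 : ∀ q ∈ thicken (0, 1) (thicken (1, 0) Z),
      q.1.val < M ∧ p + α q.1 + β q.2 ∈ thicken (β 1) (thicken (α 1) X) := by
    intro q hq
    rcases mem_thicken.1 hq with h | h
    · exact ⟨(hstep q h).1, subset_thicken _ _ (hstep q h).2⟩
    · obtain ⟨h1, h2⟩ := hstep _ h
      refine ⟨by simpa using h1, mem_thicken.2 (Or.inr ?_)⟩
      convert h2 using 1
      simp only [Prod.fst_sub, Prod.snd_sub, sub_zero, map_sub]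
      abel
  have hle : (thicken (0, 1) (thicken (1, 0) Z)).card ≤
      (thicken (β 1) (thicken (α 1) X)).card := by
    rw [← hF.card_coords p (thicken (β 1) (thicken (α 1) X))]
    exact Finset.card_le_card fun q hq => mem_coords.2 (hstep2 q hq)
  have hlast : (((M - 1 : ℕ) : ZMod L) + 1).val = M := by
    rw [← Nat.cast_succ, ZMod.val_natCast_of_lt (by omega)]; omega
  have hkey := sq_le_card_thicken_prod (X := Z) hl (by rw [hZ, hF.card_coords, hX])
    (fun j => ⟨((M - 1 : ℕ) : ZMod L) + 1, fun h => by
      have := (hstep2 _ h).1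
      simp only [hlast] at this
      omega⟩)
    (fun k => by
      obtain ⟨j, hj⟩ := hfull (p + α k)
      exact ⟨j, fun h => hj (hstep2 _ h).2⟩)
    (fun h => by
      have h1 : ((M - 1 : ℕ) : ZMod L) + 1 ∈ Z.image Prod.fst := by rw [h]; exact Finset.mem_univ _
      obtain ⟨q, hq, h2⟩ := Finset.mem_image.1 h1
      have := hval q hq
      rw [h2, hlast] at this
      omega)
  refine ⟨hkey.1.trans hle, fun h => ?_⟩
  obtain ⟨x, y, hxy⟩ := hkey.2 (by omega)
  refine ⟨p + α x + β y, fun g => ⟨fun hg => ?_, ?_⟩⟩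
  · obtain ⟨q, hq, rfl⟩ := hF.exists_eq p g
    obtain ⟨i, j, hi, hj, rfl⟩ := (hxy q).1 (mem_coords.2 ⟨hq, hg⟩)
    refine ⟨i, j, hi, hj, ?_⟩
    simp only [map_add]
    abel
  · rintro ⟨i, j, hi, hj, rfl⟩
    have := hZX _ ((hxy _).2 ⟨i, j, hi, hj, rfl⟩)
    convert this using 1
    simp only [map_add]
    abel

/-- If every `β`-line meets `X` and none is contained in `X`, then `X` gains a point on each of
the `M` lines. -/
theorem IsFrame.card_add_le_of_no_empty_line (hL : L = 2 * M) (hF : IsFrame M α β)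
    {X : Finset G} (hfull : ∀ g, ∃ j, g + β j ∉ X) (hempty : ∀ g, ∃ j, g + β j ∈ X) :
    X.card + M ≤ (thicken (β 1) X).card := by
  have hXs := hF.card_eq_sum 0 X
  have hYs := hF.card_eq_sum 0 (thicken (β 1) X)
  have h := Finset.sum_le_sum (s := Finset.univ.filter (fun k : ZMod L => k.val < M))
    (f := fun k => (lineSection β (0 + α k) X).card + 1)
    (g := fun k => (lineSection β (0 + α k) (thicken (β 1) X)).card) (by
      intro k _
      rw [thicken_lineSection]
      apply card_lt_card_thicken_one
      · obtain ⟨j, hj⟩ := hempty (0 + α k)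
        exact ⟨j, mem_lineSection.2 hj⟩
      · intro h
        obtain ⟨j, hj⟩ := hfull (0 + α k)
        exact hj (mem_lineSection.1 (by rw [h]; exact Finset.mem_univ _)))
  rw [Finset.sum_add_distrib, ← hXs, ← hYs, Finset.sum_const, card_filter_val_lt (by omega)] at h
  simpa using h

/-- The isoperimetric inequality: a set of `l ^ 2` points, `l < M`, has a thickening of at least
`(l + 1) ^ 2` points, with equality only for the rhombi. -/
theorem IsFrame.sq_le_card_thicken [Finite G] (hL : L = 2 * M) (hF : IsFrame M α β)
    (hF' : IsFrame M β α) {l : ℕ} (hl : 1 ≤ l) (hlM : l < M) {X : Finset G} (hX : X.card = l ^ 2) :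
    l ^ 2 + 2 * l + 1 ≤ (thicken (β 1) (thicken (α 1) X)).card ∧
    ((thicken (β 1) (thicken (α 1) X)).card = l ^ 2 + 2 * l + 1 →
      ∃ p, ∀ g, g ∈ X ↔ ∃ i j : ℕ, i < l ∧ j < l ∧ g = p + α i + β j) := by
  have hXM : X.card ≤ (M - 1) ^ 2 := by
    rw [hX]; exact Nat.pow_le_pow_left (by omega) 2
  suffices h : X.card + 2 * M ≤ (thicken (β 1) (thicken (α 1) X)).card ∨ _ from
    h.elim (fun h => ⟨by omega, fun h' => by omega⟩) id
  by_cases hβ : ∃ g, ∀ j, g + β j ∈ thicken (β 1) (thicken (α 1) X)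
  · obtain ⟨g, hg⟩ := hβ
    left
    rw [thicken_comm] at hg ⊢
    exact hF.card_add_le_of_full_line hL (by omega) hXM hg
  by_cases hα : ∃ g, ∀ j, g + α j ∈ thicken (β 1) (thicken (α 1) X)
  · obtain ⟨g, hg⟩ := hα
    left
    exact hF'.card_add_le_of_full_line hL (by omega) hXM hg
  push Not at hα hβ
  by_cases hβe : ∃ g, ∀ j, g + β j ∉ X
  · obtain ⟨g, hg⟩ := hβe
    exact Or.inr (hF.sq_le_card_of_empty_line hL (by omega) hl hX hβ hg)
  by_cases hαe : ∃ g, ∀ j, g + α j ∉ X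
  · obtain ⟨g, hg⟩ := hαe
    rw [thicken_comm] at hα ⊢
    obtain ⟨h1, h2⟩ := hF'.sq_le_card_of_empty_line hL (by omega) hl hX hα hg
    refine Or.inr ⟨h1, fun h => ?_⟩
    obtain ⟨p, hp⟩ := h2 h
    refine ⟨p, fun g => ?_⟩
    rw [hp]
    constructor
    · rintro ⟨i, j, hi, hj, rfl⟩
      exact ⟨j, i, hj, hi, add_right_comm _ _ _⟩
    · rintro ⟨i, j, hi, hj, rfl⟩
      exact ⟨j, i, hj, hi, add_right_comm _ _ _⟩
  push Not at hαe hβe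
  left
  have hsub := subset_thicken (α 1) X
  have hsub2 := subset_thicken (β 1) (thicken (α 1) X)
  have h1 := hF'.card_add_le_of_no_empty_line hL (X := X)
    (fun g => (hα g).imp fun j hj h => hj (hsub2 (hsub h))) hαe
  have h2 := hF.card_add_le_of_no_empty_line hL (X := thicken (α 1) X)
    (fun g => (hβ g).imp fun j hj h => hj (hsub2 h))
    (fun g => (hβe g).imp fun j hj => hsub hj)
  omega

end Isoperimetry

/-! ### The even sublattice and the boundary of sets of odd sites -/

section Parity

variable {L : ℕ}

theorem mem_evenSites_iff_even_add [NeZero L] (hL : Even L) (v : Site L) :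
    v ∈ evenSites L ↔ Even (v.1 + v.2) := by
  have hcast : ((v.1.val + v.2.val : ℕ) : ZMod L) = v.1 + v.2 := by simp
  constructor
  · rintro ⟨r, hr⟩
    exact ⟨r, by rw [← hcast, hr]; simp⟩
  · rintro ⟨k, hk⟩
    have h : ((v.1.val + v.2.val : ℕ) : ZMod L) = ((k.val + k.val : ℕ) : ZMod L) := by
      rw [hcast, hk]; simp
    rw [ZMod.natCast_eq_natCast_iff] at h
    have h2 := h.of_dvd (even_iff_two_dvd.1 hL)
    unfold Nat.ModEq at h2
    rw [evenSites, Set.mem_ofPred_eq, Nat.even_iff]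
    omega

theorem one_zero_mem_oddSites (hL : 1 < L) : ((1, 0) : Site L) ∈ oddSites L := by
  have : Fact (1 < L) := ⟨hL⟩
  simp [oddSites, ZMod.val_one]

theorem exists_unique_val_lt_half {M : ℕ} [NeZero L] (hL : L = 2 * M) (c : ZMod L) :
    ∃! k : ZMod L, k.val < M ∧ k + k = c + c := by
  have hc := ZMod.val_lt c
  have h1 : ∃ k : ZMod L, k.val < M ∧ k + k = c + c := by
    rcases Nat.lt_or_ge c.val M with h | h
    · exact ⟨c, h, rfl⟩
    · refine ⟨((c.val - M : ℕ) : ZMod L), ?_, ?_⟩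
      · rw [ZMod.val_natCast_of_lt (by omega)]; omega
      · have h3 : ((c.val - M + (c.val - M) + L : ℕ) : ZMod L) =
            ((c.val + c.val : ℕ) : ZMod L) := by
          congr 1; omega
        simpa using h3
  obtain ⟨k, hk, hkc⟩ := h1
  refine ⟨k, ⟨hk, hkc⟩, ?_⟩
  rintro k' ⟨hk', hkc'⟩
  have h := congrArg ZMod.val (hkc'.trans hkc.symm)
  rw [ZMod.val_add_of_lt (by omega), ZMod.val_add_of_lt (by omega)] at h
  exact ZMod.val_injective L (by omega)

/-- The even sublattice of the torus, as a subgroup. Parity is expressed by divisibility in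
`ZMod L`, which agrees with the parity of representatives for even `L`. The diagonals `(1, 1)` and
`(1, -1)` generate it. -/
def evenSubgroup (L : ℕ) : AddSubgroup (Site L) where
  carrier := {v | Even (v.1 + v.2)}
  add_mem' := by
    rintro v w ⟨a, ha⟩ ⟨b, hb⟩
    exact ⟨a + b, by simp only [Prod.fst_add, Prod.snd_add]; linear_combination ha + hb⟩
  zero_mem' := by simp
  neg_mem' := by
    rintro v ⟨a, ha⟩
    exact ⟨-a, by simp only [Prod.fst_neg, Prod.snd_neg]; linear_combination -ha⟩

theorem mem_evenSubgroup {v : Site L} : v ∈ evenSubgroup L ↔ Even (v.1 + v.2) := Iff.rfl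

/-- The diagonal direction `(1, 1)`. -/
def diag (L : ℕ) : ZMod L →+ evenSubgroup L where
  toFun j := ⟨(j, j), j, rfl⟩
  map_zero' := rfl
  map_add' _ _ := rfl

/-- The antidiagonal direction `(1, -1)`. -/
def antidiag (L : ℕ) : ZMod L →+ evenSubgroup L where
  toFun j := ⟨(j, -j), by simp [mem_evenSubgroup]⟩
  map_zero' := by simp
  map_add' i j := by ext <;> simp; ring

theorem coe_diag (j : ZMod L) : (diag L j : Site L) = (j, j) := rfl

theorem coe_antidiag (j : ZMod L) : (antidiag L j : Site L) = (j, -j) := rfl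

theorem isFrame_diag_antidiag {M : ℕ} [NeZero L] (hL : L = 2 * M) :
    IsFrame M (diag L) (antidiag L) := by
  rintro ⟨⟨x, y⟩, c, hc⟩
  simp only at hc
  obtain ⟨k, ⟨hk, hkc⟩, huniq⟩ := exists_unique_val_lt_half hL c
  refine ⟨(k, x - k), ⟨hk, ?_⟩, ?_⟩
  · ext
    · simp [coe_diag, coe_antidiag]
    · simp only [AddSubgroup.coe_add, coe_diag, coe_antidiag, Prod.mk_add_mk]
      linear_combination hkc - hc
  · rintro ⟨k', j'⟩ ⟨h1, h2⟩
    have h3 := congrArg Subtype.val h2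
    simp only [AddSubgroup.coe_add, coe_diag, coe_antidiag, Prod.mk_add_mk, Prod.mk.injEq] at h3
    obtain ⟨h4, h5⟩ := h3
    obtain rfl : k' = k := huniq k' ⟨h1, by linear_combination h4 + h5 + hc⟩
    rw [← h4]; simp

theorem isFrame_antidiag_diag {M : ℕ} [NeZero L] (hL : L = 2 * M) :
    IsFrame M (antidiag L) (diag L) := by
  rintro ⟨⟨x, y⟩, c, hc⟩
  simp only at hc
  obtain ⟨k, ⟨hk, hkc⟩, huniq⟩ := exists_unique_val_lt_half hL (c - y)
  refine ⟨(k, x - k), ⟨hk, ?_⟩, ?_⟩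
  · ext
    · simp [coe_diag, coe_antidiag]
    · simp only [AddSubgroup.coe_add, coe_diag, coe_antidiag, Prod.mk_add_mk]
      linear_combination hc - hkc
  · rintro ⟨k', j'⟩ ⟨h1, h2⟩
    have h3 := congrArg Subtype.val h2
    simp only [AddSubgroup.coe_add, coe_diag, coe_antidiag, Prod.mk_add_mk, Prod.mk.injEq] at h3
    obtain ⟨h4, h5⟩ := h3
    obtain rfl : k' = k := huniq k' ⟨h1, by linear_combination h4 - h5 + hc⟩
    rw [← h4]; simp

end Parity

section Grid

variable {L : ℕ}

/-- The four unit steps on the torus. -/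
def unitSteps (L : ℕ) : Set (Site L) := {(1, 0), (-1, 0), (0, 1), (0, -1)}

theorem mem_unitSteps {d : Site L} :
    d ∈ unitSteps L ↔ d = (1, 0) ∨ d = (-1, 0) ∨ d = (0, 1) ∨ d = (0, -1) := by
  simp [unitSteps]

theorem neg_mem_unitSteps {d : Site L} (hd : d ∈ unitSteps L) : -d ∈ unitSteps L := by
  rw [mem_unitSteps] at hd ⊢
  rcases hd with rfl | rfl | rfl | rfl <;> simp

theorem ncard_unitSteps (hL : 2 < L) : (unitSteps L).ncard = 4 := by
  have : Fact (1 < L) := ⟨by omega⟩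
  have : Fact (2 < L) := ⟨hL⟩
  have h1 : (1 : ZMod L) ≠ -1 := (ZMod.neg_one_ne_one).symm
  have h0 : (1 : ZMod L) ≠ 0 := one_ne_zero
  rw [unitSteps, Set.ncard_insert_of_notMem, Set.ncard_insert_of_notMem, Set.ncard_pair]
  · simp [h1]
  · simp [h0]
  · simp [h1, h0]

theorem toricGrid_adj_iff (hL : 1 < L) {v w : Site L} :
    (toricGrid L).Adj v w ↔ w - v ∈ unitSteps L := by
  have : Fact (1 < L) := ⟨hL⟩
  have hcirc : ∀ a b : ZMod L, (SimpleGraph.circulantGraph ({1} : Set (ZMod L))).Adj a b ↔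
      b - a = 1 ∨ b - a = -1 := by
    intro a b
    rw [SimpleGraph.circulantGraph, SimpleGraph.fromRel_adj, Set.mem_singleton_iff,
      Set.mem_singleton_iff, or_comm, ← neg_sub b a, neg_eq_iff_eq_neg]
    refine ⟨And.right, fun h => ⟨?_, h⟩⟩
    rintro rfl
    simp at h
  rw [toricGrid, SimpleGraph.boxProd_adj, hcirc, hcirc, mem_unitSteps]
  simp only [Prod.ext_iff, Prod.fst_sub, Prod.snd_sub, sub_eq_zero, eq_comm (a := v.1),
    eq_comm (a := v.2)]
  tauto

theorem even_add_unitStep [NeZero L] (hL : Even L) (hL1 : 1 < L) {v d : Site L}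
    (hd : d ∈ unitSteps L) : v + d ∈ evenSites L ↔ v ∈ oddSites L := by
  have h : (toricGrid L).Adj v (v + d) := by
    rw [toricGrid_adj_iff hL1]; simpa using hd
  exact (parity_of_adj hL (NeZero.ne L) h).symm

theorem odd_add_unitStep [NeZero L] (hL : Even L) (hL1 : 1 < L) {v d : Site L}
    (hd : d ∈ unitSteps L) : v + d ∈ oddSites L ↔ v ∈ evenSites L := by
  rw [mem_oddSites_iff, even_add_unitStep hL hL1 hd, mem_oddSites_iff, not_not]

/-- For a set `O` of odd sites the condition `v ∉ O` in the definition of `∂⁺ O` is automatic. -/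
theorem mem_extBoundary_iff [NeZero L] (hL : Even L) (hL1 : 1 < L) {O : Set (Site L)}
    (hO : O ⊆ oddSites L) {v : Site L} :
    v ∈ extBoundary O ↔ ∃ d ∈ unitSteps L, v + d ∈ O := by
  constructor
  · rintro ⟨-, w, hw, h⟩
    exact ⟨w - v, (toricGrid_adj_iff hL1).1 h, by simpa using hw⟩
  · rintro ⟨d, hd, h⟩
    refine ⟨fun hv => ?_, v + d, h, (toricGrid_adj_iff hL1).2 (by simpa using hd)⟩
    have h1 := (odd_add_unitStep hL hL1 hd).1 (hO h)
    exact (mem_oddSites_iff v).1 (hO hv) h1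

theorem extBoundary_subset_evenSites [NeZero L] (hL : Even L) (hL1 : 1 < L) {O : Set (Site L)}
    (hO : O ⊆ oddSites L) : extBoundary O ⊆ evenSites L := by
  intro v hv
  obtain ⟨d, hd, h⟩ := (mem_extBoundary_iff hL hL1 hO).1 hv
  exact (odd_add_unitStep hL hL1 hd).1 (hO h)

/-- The isoperimetric inequality for sets of odd sites. The set `O` is translated by `(-1, 0)`
into the even sublattice; there `∂⁺ O` becomes the thickening along both diagonals. -/
theorem sq_le_ncard_extBoundary {M : ℕ} [NeZero L] (hL : L = 2 * M) {l : ℕ} (hl : 1 ≤ l)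
    (hlM : l < M) {O : Set (Site L)} (hO : O ⊆ oddSites L) (hOc : O.ncard = l ^ 2) :
    l ^ 2 + 2 * l + 1 ≤ (extBoundary O).ncard ∧
    ((extBoundary O).ncard = l ^ 2 + 2 * l + 1 →
      ∃ η ∈ oddSites L, O = rhombusOddSites l l η) := by
  classical
  have hLe : Even L := ⟨M, by omega⟩
  have hL1 : 1 < L := by omega
  have he1 : ((1, 0) : Site L) ∈ unitSteps L := by simp [unitSteps]
  let X : Finset (evenSubgroup L) := Finset.univ.filter (fun h => (h : Site L) + (1, 0) ∈ O)
  have hX : ∀ h, h ∈ X ↔ (h : Site L) + (1, 0) ∈ O := by simp [X]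
  have hsh : ∀ v ∈ O, v - (1, 0) ∈ evenSubgroup L := by
    intro v hv
    rw [mem_evenSubgroup, ← mem_evenSites_iff_even_add hLe, ← odd_add_unitStep hLe hL1 he1,
      sub_add_cancel]
    exact hO hv
  have hXc : X.card = O.ncard := by
    rw [← Set.ncard_coe_finset]
    refine Set.ncard_congr (fun h _ => (h : Site L) + (1, 0)) (fun h hh => (hX h).1 hh)
      (fun a b _ _ hab => Subtype.ext (add_right_cancel hab)) ?_
    intro v hv
    exact ⟨⟨v - (1, 0), hsh v hv⟩, (hX _).2 (by simpa using hv), by simp⟩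
  have hN : ∀ h : evenSubgroup L,
      h ∈ thicken (antidiag L 1) (thicken (diag L 1) X) ↔ (h : Site L) ∈ extBoundary O := by
    intro h
    rw [mem_extBoundary_iff hLe hL1 hO, mem_thicken, mem_thicken, mem_thicken]
    simp only [hX, mem_unitSteps, AddSubgroup.coe_sub, coe_diag, coe_antidiag]
    have e1 : (h : Site L) - (1, 1) + (1, 0) = (h : Site L) + (0, -1) := by ext <;> simp; ring
    have e2 : (h : Site L) - (1, -1) + (1, 0) = (h : Site L) + (0, 1) := by ext <;> simp
    have e3 : (h : Site L) - (1, -1) - (1, 1) + (1, 0) = (h : Site L) + (-1, 0) := by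
      ext <;> simp; ring
    rw [e1, e2, e3]
    constructor
    · rintro ((h | h) | (h | h))
      · exact ⟨_, by simp, h⟩
      · exact ⟨_, by simp, h⟩
      · exact ⟨_, by simp, h⟩
      · exact ⟨_, by simp, h⟩
    · rintro ⟨d, rfl | rfl | rfl | rfl, h⟩ <;> tauto
  have hNc : (thicken (antidiag L 1) (thicken (diag L 1) X)).card = (extBoundary O).ncard := by
    rw [← Set.ncard_coe_finset]
    refine Set.ncard_congr (fun h _ => (h : Site L)) (fun h hh => (hN h).1 hh)
      (fun a b _ _ hab => Subtype.ext hab) ?_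
    intro v hv
    have hv' : v ∈ evenSubgroup L := by
      rw [mem_evenSubgroup, ← mem_evenSites_iff_even_add hLe]
      exact extBoundary_subset_evenSites hLe hL1 hO hv
    exact ⟨⟨v, hv'⟩, (hN _).2 hv, rfl⟩
  have key := (isFrame_diag_antidiag hL).sq_le_card_thicken hL (isFrame_antidiag_diag hL) hl hlM
    (hXc.trans hOc)
  rw [hNc] at key
  refine ⟨key.1, fun h => ?_⟩
  obtain ⟨p, hp⟩ := key.2 h
  refine ⟨(p : Site L) + (1, 0), ?_, ?_⟩
  · exact (odd_add_unitStep hLe hL1 he1).2 ((mem_evenSites_iff_even_add hLe _).2 p.2)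
  · have hcoord : ∀ i j : ℕ, ((p + diag L i + antidiag L j : evenSubgroup L) : Site L) + (1, 0) =
        (((p : Site L) + (1, 0)).1 + (i : ZMod L) + (j : ZMod L),
          ((p : Site L) + (1, 0)).2 + (i : ZMod L) - (j : ZMod L)) := by
      intro i j
      ext
      · simp [coe_diag, coe_antidiag]; ring
      · simp [coe_diag, coe_antidiag]; ring
    ext v
    constructor
    · intro hv
      obtain ⟨i, j, hi, hj, hij⟩ := (hp ⟨v - (1, 0), hsh v hv⟩).1 ((hX _).2 (by simpa using hv))
      refine ⟨i, j, hi, hj, ?_⟩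
      rw [← hcoord, ← hij]
      simp
    · rintro ⟨i, j, hi, hj, rfl⟩
      rw [← hcoord, ← hX, hp]
      exact ⟨i, j, hi, hj, rfl⟩

theorem ncard_rhombusOddSites {M : ℕ} [NeZero L] (hL : L = 2 * M) {l : ℕ} (hlM : l ≤ M)
    (η : Site L) : (rhombusOddSites l l η).ncard = l ^ 2 := by
  classical
  have h : rhombusOddSites l l η = ((Finset.range l ×ˢ Finset.range l).image (fun q : ℕ × ℕ =>
      ((η.1 + (q.1 : ZMod L) + (q.2 : ZMod L), η.2 + (q.1 : ZMod L) - (q.2 : ZMod L)) : Site L)) :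
      Finset (Site L)) := by
    ext v
    simp only [rhombusOddSites, Set.mem_ofPred_eq, Finset.coe_image, Set.mem_image,
      Finset.mem_coe, Finset.mem_product, Finset.mem_range, Prod.exists]
    constructor
    · rintro ⟨k, j, hk, hj, rfl⟩
      exact ⟨k, j, ⟨hk, hj⟩, rfl⟩
    · rintro ⟨k, j, ⟨hk, hj⟩, rfl⟩
      exact ⟨k, j, hk, hj, rfl⟩
  rw [h, Set.ncard_coe_finset, Finset.card_image_of_injOn, Finset.card_product,
    Finset.card_range, sq]
  rintro ⟨k, j⟩ hkj ⟨k', j'⟩ hkj' he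
  simp only [Finset.coe_product, Finset.coe_range, Set.mem_prod, Set.mem_Iio] at hkj hkj'
  simp only [Prod.mk.injEq] at he
  obtain ⟨h1, h2⟩ := he
  have hk : ((k + k : ℕ) : ZMod L) = ((k' + k' : ℕ) : ZMod L) := by
    push_cast; linear_combination h1 + h2
  have hj : ((j + j : ℕ) : ZMod L) = ((j' + j' : ℕ) : ZMod L) := by
    push_cast; linear_combination h1 - h2
  have hinj : ∀ a b : ℕ, a < L → b < L → (a : ZMod L) = b → a = b := by
    intro a b ha hb hab
    have := congrArg ZMod.val hab
    rwa [ZMod.val_natCast_of_lt ha, ZMod.val_natCast_of_lt hb] at this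
  have hk' := hinj _ _ (by omega) (by omega) hk
  have hj' := hinj _ _ (by omega) (by omega) hj
  ext <;> simp only <;> omega

theorem rhombusOddSites_subset_oddSites [NeZero L] (hL : Even L) {l₁ l₂ : ℕ} {η : Site L}
    (hη : η ∈ oddSites L) : rhombusOddSites l₁ l₂ η ⊆ oddSites L := by
  rintro v ⟨k, j, -, -, rfl⟩
  rw [mem_oddSites_iff, mem_evenSites_iff_even_add hL] at hη ⊢
  rintro ⟨c, hc⟩
  exact hη ⟨c - k, by linear_combination hc⟩

/-- The even sites of a square rhombus form a diagonal square with one more site per side. -/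
theorem extBoundary_rhombusOddSites [NeZero L] (hL : Even L) (hL1 : 1 < L) {l : ℕ} (hl : 1 ≤ l)
    {η : Site L} (hη : η ∈ oddSites L) :
    extBoundary (rhombusOddSites l l η) = rhombusOddSites (l + 1) (l + 1) (η - (1, 0)) := by
  ext v
  rw [mem_extBoundary_iff hL hL1 (rhombusOddSites_subset_oddSites hL hη)]
  constructor
  · rintro ⟨d, hd, k, j, hk, hj, h⟩
    have hv : v = (η.1 + k + j, η.2 + k - j) - d := by rw [← h]; simp
    rw [mem_unitSteps] at hd
    rcases hd with rfl | rfl | rfl | rfl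
    · exact ⟨k, j, by omega, by omega, by rw [hv]; ext <;> simp; ring⟩
    · exact ⟨k + 1, j + 1, by omega, by omega, by rw [hv]; ext <;> simp <;> ring⟩
    · exact ⟨k, j + 1, by omega, by omega, by rw [hv]; ext <;> simp <;> ring⟩
    · exact ⟨k + 1, j, by omega, by omega, by rw [hv]; ext <;> simp; ring⟩
  · rintro ⟨k, j, hk, hj, rfl⟩
    rcases Nat.lt_or_ge k l with hkl | hkl
    · rcases Nat.lt_or_ge j l with hjl | hjl
      · exact ⟨(1, 0), by simp [unitSteps], k, j, hkl, hjl, by ext <;> simp; ring⟩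
      · obtain ⟨j, rfl⟩ := Nat.exists_eq_succ_of_ne_zero (n := j) (by omega)
        exact ⟨(0, 1), by simp [unitSteps], k, j, hkl, by omega, by ext <;> simp <;> ring⟩
    · obtain ⟨k, rfl⟩ := Nat.exists_eq_succ_of_ne_zero (n := k) (by omega)
      rcases Nat.lt_or_ge j l with hjl | hjl
      · exact ⟨(0, -1), by simp [unitSteps], k, j, by omega, hjl, by ext <;> simp; ring⟩
      · obtain ⟨j, rfl⟩ := Nat.exists_eq_succ_of_ne_zero (n := j) (by omega)
        exact ⟨(-1, 0), by simp [unitSteps], k, j, by omega, by omega, by ext <;> simp <;> ring⟩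

end Grid

/-! ### Perimeters, rhombi and minimisers -/

section Perimeter

variable {L : ℕ}

/-- The sets that contain all neighbours of each of their odd sites. -/
def IsOddClosed (C : Set (Site L)) : Prop :=
  ∀ v ∈ C, v ∈ oddSites L → ∀ w, (toricGrid L).Adj v w → w ∈ C

theorem IsOddCluster.isOddClosed {C : Set (Site L)} (hC : IsOddCluster C) : IsOddClosed C :=
  fun v hv hvo _ hvw => hC.1 v hv hvo ⟨hvw.ne', v, rfl, hvw.symm⟩

theorem IsHardCore.isOddClosed [NeZero L] (hL : Even L) {σ : Site L → Fin 2} (hσ : IsHardCore σ) :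
    IsOddClosed (oddRegion σ) := by
  rintro v (hv | hv) hvo w hvw
  · have h := hσ v w hvw
    rw [hv.2, one_mul] at h
    exact Or.inr ⟨(parity_of_adj hL (NeZero.ne L) hvw).1 hvo, h⟩
  · exact absurd hv.1 ((mem_oddSites_iff v).1 hvo)

theorem ncard_inter_add_ncard_inter [NeZero L] (C : Set (Site L)) :
    (C ∩ oddSites L).ncard + (C ∩ evenSites L).ncard = C.ncard := by
  have h : C ∩ evenSites L = C \ oddSites L := by
    ext v
    simp [mem_oddSites_iff]
  rw [h, Set.ncard_inter_add_ncard_sdiff_eq_ncard C (oddSites L) (Set.toFinite C)]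

/-- Of the four edges at each even site of `C`, those leading to an odd site of `C` are counted
once among the four edges of that site; the others form `∇ C`. -/
theorem clusterPerimeter_add [NeZero L] (hL : Even L) (hL2 : 2 < L) {C : Set (Site L)}
    (hC : IsOddClosed C) :
    clusterPerimeter C + 4 * (C ∩ oddSites L).ncard = 4 * (C ∩ evenSites L).ncard := by
  have hL1 : 1 < L := by omega
  have hoe := mem_oddSites_iff (L := L)
  have hadd : ∀ v d : Site L, d ∈ unitSteps L → (toricGrid L).Adj v (v + d) := fun v d hd =>
    (toricGrid_adj_iff hL1).2 (by simpa using hd)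
  set A : Set (Site L × Site L) := (C ∩ evenSites L) ×ˢ unitSteps L with hA
  set T : Set (Site L × Site L) := {q | q.1 + q.2 ∈ C} with hT
  have hAc : A.ncard = 4 * (C ∩ evenSites L).ncard := by
    rw [hA, Set.ncard_prod, ncard_unitSteps hL2, mul_comm]
  have hin : (A ∩ T).ncard = 4 * (C ∩ oddSites L).ncard := by
    have h : (A ∩ T).ncard = ((C ∩ oddSites L) ×ˢ unitSteps L).ncard := by
      refine Set.ncard_congr (fun q _ => (q.1 + q.2, -q.2)) ?_ ?_ ?_
      · rintro ⟨v, d⟩ ⟨⟨⟨-, hve⟩, hd⟩, hT⟩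
        exact ⟨⟨hT, (odd_add_unitStep hL hL1 hd).2 hve⟩, neg_mem_unitSteps hd⟩
      · rintro ⟨v, d⟩ ⟨v', d'⟩ _ _ h
        simp only [Prod.mk.injEq, neg_inj] at h
        obtain ⟨h1, rfl⟩ := h
        rw [add_right_cancel h1]
      · rintro ⟨w, d⟩ ⟨⟨hw, hwo⟩, hd⟩
        refine ⟨(w + d, -d), ⟨⟨⟨hC w hw hwo _ (hadd w d hd), ?_⟩, neg_mem_unitSteps hd⟩, ?_⟩, ?_⟩
        · exact (even_add_unitStep hL hL1 hd).2 hwo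
        · simpa [hT] using hw
        · simp
    rw [h, Set.ncard_prod, ncard_unitSteps hL2, mul_comm]
  have hout : (A \ T).ncard = clusterPerimeter C := by
    refine Set.ncard_congr (fun q _ => s(q.1, q.1 + q.2)) ?_ ?_ ?_
    · rintro ⟨v, d⟩ ⟨⟨⟨hv, hve⟩, hd⟩, hT⟩
      exact ⟨hadd v d hd, v, hv, v + d, ⟨hT, v, hv, (hadd v d hd).symm⟩, rfl⟩
    · rintro ⟨v, d⟩ ⟨v', d'⟩ ⟨⟨⟨_, hve⟩, _⟩, _⟩ ⟨⟨⟨_, hve'⟩, hd'⟩, _⟩ h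
      simp only [Sym2.eq_iff] at h
      simp only at hve hve' hd'
      rcases h with ⟨rfl, h2⟩ | ⟨h1, -⟩
      · rw [add_left_cancel h2]
      · rw [h1] at hve
        exact absurd hve' ((hoe v').1 ((even_add_unitStep hL hL1 hd').1 hve))
    · rintro e ⟨he, v, hv, w, ⟨hw, -⟩, rfl⟩
      have hvw : (toricGrid L).Adj v w := he
      have hve : v ∈ evenSites L := by
        by_contra h
        exact hw (hC v hv ((hoe v).2 h) w hvw)
      exact ⟨(v, w - v), ⟨⟨⟨hv, hve⟩, (toricGrid_adj_iff hL1).1 hvw⟩, by simpa [hT] using hw⟩,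
        by simp⟩
  have := Set.ncard_inter_add_ncard_sdiff_eq_ncard A T (Set.toFinite A)
  omega

theorem biUnion_oddClusters (σ : Site L → Fin 2) : ⋃ C ∈ oddClusters σ, C = oddRegion σ := by
  ext v
  simp only [Set.mem_iUnion, exists_prop]
  constructor
  · rintro ⟨_, ⟨c, rfl⟩, x, -, rfl⟩
    exact x.2
  · intro hv
    exact ⟨_, ⟨SimpleGraph.connectedComponentMk _ ⟨v, hv⟩, rfl⟩, ⟨v, hv⟩, rfl, rfl⟩

theorem pairwiseDisjoint_oddClusters (σ : Site L → Fin 2) :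
    (oddClusters σ).PairwiseDisjoint id := by
  rintro _ ⟨c, rfl⟩ _ ⟨c', rfl⟩ hne
  refine Set.disjoint_left.2 ?_
  rintro _ ⟨x, hx, rfl⟩ ⟨y, hy, hyx⟩
  obtain rfl := Subtype.ext hyx
  rw [SimpleGraph.ConnectedComponent.mem_supp_iff] at hx hy
  exact hne (by rw [← hx, ← hy])

/-- The number of sites of the odd region in `S`, summed over the clusters. -/
theorem finsum_ncard_inter_oddClusters [NeZero L] (σ : Site L → Fin 2) (S : Set (Site L)) :
    ∑ᶠ C ∈ oddClusters σ, (C ∩ S).ncard = (oddRegion σ ∩ S).ncard := by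
  rw [← biUnion_oddClusters σ, Set.iUnion₂_inter,
    (Set.toFinite (oddClusters σ)).ncard_biUnion (fun _ _ => Set.toFinite _)]
  exact fun C hC D hD hne => ((pairwiseDisjoint_oddClusters σ) hC hD hne).mono
    Set.inter_subset_left Set.inter_subset_left

theorem IsHardCore.perimeter_add (hL : Even L) (hL6 : 6 ≤ L) {σ : Site L → Fin 2}
    (hσ : IsHardCore σ) :
    perimeter σ + 4 * (oddRegion σ ∩ oddSites L).ncard =
      4 * (oddRegion σ ∩ evenSites L).ncard := by
  have : NeZero L := ⟨by omega⟩
  have hfin := Set.toFinite (oddClusters σ)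
  rw [perimeter, ← finsum_ncard_inter_oddClusters, ← finsum_ncard_inter_oddClusters,
    finsum_mem_eq_finite_toFinset_sum _ hfin, finsum_mem_eq_finite_toFinset_sum _ hfin,
    finsum_mem_eq_finite_toFinset_sum _ hfin, Finset.mul_sum, Finset.mul_sum,
    ← Finset.sum_add_distrib]
  refine Finset.sum_congr rfl fun C hC => ?_
  have hC' := isOddCluster_of_mem_oddClusters hL hL6 hσ (hfin.mem_toFinset.1 hC)
  exact clusterPerimeter_add hL (by omega) hC'.isOddClosed

theorem realArea_eq_ncard [NeZero L] (σ : Site L → Fin 2) : realArea σ = (oddRegion σ).ncard := by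
  rw [realArea, oddRegion, Set.ncard_union_eq _ (Set.toFinite _) (Set.toFinite _)]
  exact Set.disjoint_left.2 fun v h1 h2 => (mem_oddSites_iff v).1 h1.1 h2.1

end Perimeter

section Rhombus

variable {L M : ℕ} [NeZero L]

theorem rhombus_inter_oddSites (hL : Even L) (hL1 : 1 < L) {l : ℕ} {η : Site L}
    (hη : η ∈ oddSites L) : rhombus l l η ∩ oddSites L = rhombusOddSites l l η := by
  have hO := rhombusOddSites_subset_oddSites hL (l₁ := l) (l₂ := l) hη
  ext v
  constructor
  · rintro ⟨h | h, hv⟩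
    · exact h
    · exact absurd (extBoundary_subset_evenSites hL hL1 hO h) ((mem_oddSites_iff v).1 hv)
  · exact fun h => ⟨Or.inl h, hO h⟩

theorem rhombus_inter_evenSites (hL : Even L) (hL1 : 1 < L) {l : ℕ} {η : Site L}
    (hη : η ∈ oddSites L) :
    rhombus l l η ∩ evenSites L = extBoundary (rhombusOddSites l l η) := by
  have hO := rhombusOddSites_subset_oddSites hL (l₁ := l) (l₂ := l) hη
  ext v
  constructor
  · rintro ⟨h | h, hv⟩
    · exact absurd hv ((mem_oddSites_iff v).1 (hO h))
    · exact h
  · exact fun h => ⟨Or.inr h, extBoundary_subset_evenSites hL hL1 hO h⟩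

theorem isOddClosed_rhombus (hL : Even L) (hL1 : 1 < L) {l : ℕ} {η : Site L}
    (hη : η ∈ oddSites L) : IsOddClosed (rhombus l l η) := by
  intro v hv hvo w hvw
  have h : v ∈ rhombusOddSites l l η := by
    rw [← rhombus_inter_oddSites hL hL1 hη]; exact ⟨hv, hvo⟩
  refine Or.inr ⟨fun hw => ?_, v, h, hvw.symm⟩
  exact (mem_oddSites_iff w).1 (rhombusOddSites_subset_oddSites hL hη hw)
    ((parity_of_adj hL (NeZero.ne L) hvw).1 hvo)

theorem ncard_extBoundary_rhombusOddSites (hL : L = 2 * M) {l : ℕ} (hl : 1 ≤ l) (hlM : l < M)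
    {η : Site L} (hη : η ∈ oddSites L) :
    (extBoundary (rhombusOddSites l l η)).ncard = (l + 1) ^ 2 := by
  rw [extBoundary_rhombusOddSites ⟨M, by omega⟩ (by omega) hl hη,
    ncard_rhombusOddSites hL (by omega)]

theorem ncard_rhombus (hL : L = 2 * M) {l : ℕ} (hl : 1 ≤ l) (hlM : l < M) {η : Site L}
    (hη : η ∈ oddSites L) : (rhombus l l η).ncard = 2 * l ^ 2 + 2 * l + 1 := by
  have hLe : Even L := ⟨M, by omega⟩
  rw [← ncard_inter_add_ncard_inter, rhombus_inter_oddSites hLe (by omega) hη,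
    rhombus_inter_evenSites hLe (by omega) hη, ncard_rhombusOddSites hL (by omega),
    ncard_extBoundary_rhombusOddSites hL hl hlM hη]
  ring

theorem exists_isHardCore_oddRegion_eq_rhombus (hL : Even L) (hL1 : 1 < L) {l : ℕ} {η : Site L}
    (hη : η ∈ oddSites L) :
    ∃ σ : Site L → Fin 2, IsHardCore σ ∧ oddRegion σ = rhombus l l η := by
  classical
  -- a site is occupied if it is odd and inside the rhombus, or even and outside it
  have hoe := mem_oddSites_iff (L := L)
  refine ⟨fun v => if (v ∈ rhombus l l η ↔ v ∈ oddSites L) then 1 else 0, ?_, ?_⟩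
  · have hcl := isOddClosed_rhombus hL hL1 (l := l) hη
    have key : ∀ v w : Site L, v ∈ oddSites L → (toricGrid L).Adj v w →
        ¬ (v ∈ rhombus l l η ↔ v ∈ oddSites L) ∨ ¬ (w ∈ rhombus l l η ↔ w ∈ oddSites L) := by
      intro v w hv hvw
      have hw : w ∉ oddSites L := by
        rw [hoe, not_not]; exact (parity_of_adj hL (NeZero.ne L) hvw).1 hv
      by_cases hvr : v ∈ rhombus l l η
      · exact Or.inr fun h => hw (h.1 (hcl v hvr hv w hvw))
      · exact Or.inl fun h => hvr (h.2 hv)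
    intro v w hvw
    simp only
    by_cases hv : v ∈ oddSites L
    · rcases key v w hv hvw with h | h <;> simp [h]
    · have hw : w ∈ oddSites L :=
        (parity_of_adj hL (NeZero.ne L) hvw.symm).2 (not_not.1 (mt (hoe v).2 hv))
      rcases key w v hw hvw.symm with h | h <;> simp [h]
  · ext v
    simp only [oddRegion, Set.mem_union, Set.mem_ofPred_eq]
    by_cases hv : v ∈ oddSites L
    · have hv' := (hoe v).1 hv
      by_cases hr : v ∈ rhombus l l η <;> simp [hv, hv', hr]
    · have hv' := not_not.1 (mt (hoe v).2 hv)
      by_cases hr : v ∈ rhombus l l η <;> simp [hv, hv', hr]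

/-- The even sites of a rhombus are connected: each is joined to the reference corner
`η - (1, 0)` by diagonal steps along the two sides. -/
theorem isOddCluster_rhombus (hL : Even L) (hL2 : 2 < L) {l : ℕ} (hl : 1 ≤ l) {η : Site L}
    (hη : η ∈ oddSites L) : IsOddCluster (rhombus l l η) := by
  have hL1 : 1 < L := by omega
  have : Fact (1 < L) := ⟨hL1⟩
  refine ⟨?_, ?_⟩
  · rintro v hv hvo w ⟨-, u, hu, hwu⟩
    rw [Set.mem_singleton_iff.1 hu] at hwu
    exact isOddClosed_rhombus hL hL1 hη v hv hvo w hwu.symm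
  have hE : rhombus l l η ∩ evenSites L = rhombusOddSites (l + 1) (l + 1) (η - (1, 0)) := by
    rw [rhombus_inter_evenSites hL hL1 hη, extBoundary_rhombusOddSites hL hL1 hl hη]
  rw [hE]
  have heven : rhombusOddSites (l + 1) (l + 1) (η - (1, 0)) ⊆ evenSites L := by
    rw [← hE]; exact Set.inter_subset_right
  set S := rhombusOddSites (l + 1) (l + 1) (η - (1, 0)) with hS
  have hadj : ∀ v w : S, ∀ d d' : Site L, d ∈ unitSteps L → d' ∈ unitSteps L →
      w.1 = v.1 + (d + d') → v.1 ≠ w.1 → ((evenGraph L).induce S).Reachable v w := by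
    intro v w d d' hd hd' hw hne
    apply SimpleGraph.Adj.reachable
    refine ⟨heven v.2, heven w.2, dist_eq_two hL (NeZero.ne L) (heven v.2) (heven w.2)
      (v := v.1 + d) ?_ ?_ hne⟩
    · rw [toricGrid_adj_iff hL1]
      simpa using neg_mem_unitSteps hd
    · rw [toricGrid_adj_iff hL1]
      change w.1 - (v.1 + d) ∈ unitSteps L
      rwa [hw, ← add_assoc, add_sub_cancel_left]
  let pt : ∀ k j : ℕ, k < l + 1 → j < l + 1 → S := fun k j hk hj =>
    ⟨((η - (1, 0)).1 + (k : ZMod L) + (j : ZMod L),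
      (η - (1, 0)).2 + (k : ZMod L) - (j : ZMod L)), k, j, hk, hj, rfl⟩
  have hreach : ∀ k j (hk : k < l + 1) (hj : j < l + 1),
      ((evenGraph L).induce S).Reachable (pt 0 0 (by omega) (by omega)) (pt k j hk hj) := by
    intro k
    induction k with
    | zero =>
      intro j
      induction j with
      | zero => intro _ _; exact SimpleGraph.Reachable.refl _
      | succ j ih =>
        intro hk hj
        refine (ih hk (by omega)).trans (hadj _ _ (1, 0) (0, -1) (by simp [unitSteps])
          (by simp [unitSteps]) ?_ ?_)
        · ext <;> simp [pt] <;> ring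
        · intro h
          have := congrArg Prod.fst h
          simp [pt] at this
    | succ k ih =>
      intro j hk hj
      refine (ih j (by omega) hj).trans (hadj _ _ (1, 0) (0, 1) (by simp [unitSteps])
        (by simp [unitSteps]) ?_ ?_)
      · ext <;> simp [pt] <;> ring
      · intro h
        have := congrArg Prod.snd h
        simp [pt] at this
  refine (SimpleGraph.connected_iff _).mpr ⟨?_, ⟨pt 0 0 (by omega) (by omega)⟩⟩
  rintro ⟨v, k, j, hk, hj, rfl⟩ ⟨w, k', j', hk', hj', rfl⟩
  exact (hreach k j hk hj).symm.trans (hreach k' j' hk' hj')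

/-- A closed region of `2 * l ^ 2 + 2 * l + 1` sites has at most `l ^ 2` odd sites, and only the
rhombi attain this: `l ^ 2` odd sites have at least `(l + 1) ^ 2` neighbours. -/
theorem IsOddClosed.ncard_inter_oddSites_le (hL : L = 2 * M) {l : ℕ} (hl : 1 ≤ l) (hlM : l < M)
    {C : Set (Site L)} (hC : IsOddClosed C) (hCn : C.ncard = 2 * l ^ 2 + 2 * l + 1) :
    (C ∩ oddSites L).ncard ≤ l ^ 2 ∧
      ((C ∩ oddSites L).ncard = l ^ 2 → ∃ η ∈ oddSites L, C = rhombus l l η) := by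
  have hLe : Even L := ⟨M, by omega⟩
  have hsum := ncard_inter_add_ncard_inter C
  rw [hCn] at hsum
  have hsub : ∀ O ⊆ C ∩ oddSites L, extBoundary O ⊆ C ∩ evenSites L := by
    intro O hO v hv
    refine ⟨?_, extBoundary_subset_evenSites hLe (by omega) (fun w hw => (hO hw).2) hv⟩
    obtain ⟨-, w, hw, hvw⟩ := hv
    exact hC w (hO hw).1 (hO hw).2 v hvw.symm
  refine ⟨?_, fun h => ?_⟩
  · by_contra! hlt
    obtain ⟨O, hO, hOc⟩ := Set.exists_subset_card_eq hlt.le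
    have h1 := (sq_le_ncard_extBoundary hL hl hlM (fun w hw => (hO hw).2) hOc).1
    have h2 := Set.ncard_le_ncard (hsub O hO) (Set.toFinite _)
    omega
  · obtain ⟨h1, h2⟩ := sq_le_ncard_extBoundary hL hl hlM (Set.inter_subset_right) h
    have h3 := Set.ncard_le_ncard (hsub _ subset_rfl) (Set.toFinite _)
    have h4 := Set.eq_of_subset_of_ncard_le (hsub _ subset_rfl) (by omega) (Set.toFinite _)
    obtain ⟨η, hη, hO⟩ := h2 (by omega)
    refine ⟨η, hη, ?_⟩
    rw [rhombus, ← hO, h4, ← Set.inter_union_distrib_left]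
    ext v
    have := mem_oddSites_iff v
    simp only [Set.mem_inter_iff, Set.mem_union]
    tauto

theorem rhombusIsUniqueMinimizer (hL : L = 2 * M) (hL6 : 6 ≤ L) {l : ℕ} (hl : 1 ≤ l)
    (hlM : l < M) : RhombusIsUniqueMinimizer L l (2 * l ^ 2 + 2 * l + 1) := by
  have hLe : Even L := ⟨M, by omega⟩
  have hL1 : 1 < L := by omega
  have hodd : ∀ η ∈ oddSites L, (rhombus l l η ∩ oddSites L).ncard = l ^ 2 := fun η hη => by
    rw [rhombus_inter_oddSites hLe hL1 hη, ncard_rhombusOddSites hL (by omega)]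
  have hη₀ := one_zero_mem_oddSites hL1
  refine ⟨fun η hη => exists_isHardCore_oddRegion_eq_rhombus hLe hL1 hη, fun σ hσ => ?_,
    fun C => ?_⟩
  · constructor
    · rintro ⟨-, hn, hmin⟩
      obtain ⟨τ, hτ, hτr⟩ := exists_isHardCore_oddRegion_eq_rhombus hLe hL1 (l := l) hη₀
      have h1 := hmin τ hτ (by rw [realArea_eq_ncard, hτr, ncard_rhombus hL hl hlM hη₀])
      rw [realArea_eq_ncard] at hn
      have h2 := hσ.perimeter_add hLe hL6
      have h3 := hτ.perimeter_add hLe hL6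
      have h4 := ncard_inter_add_ncard_inter (oddRegion σ)
      have h5 := ncard_inter_add_ncard_inter (oddRegion τ)
      have h6 := (hσ.isOddClosed hLe).ncard_inter_oddSites_le hL hl hlM hn
      have h7 := ncard_rhombus hL hl hlM hη₀
      have h8 := hodd _ hη₀
      rw [← hτr] at h7 h8
      exact h6.2 (by omega)
    · rintro ⟨η, hη, hr⟩
      have hn : realArea σ = 2 * l ^ 2 + 2 * l + 1 := by
        rw [realArea_eq_ncard, hr, ncard_rhombus hL hl hlM hη]
      refine ⟨hσ, hn, fun τ hτ hτn => ?_⟩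
      rw [realArea_eq_ncard] at hn hτn
      have h2 := hσ.perimeter_add hLe hL6
      have h3 := hτ.perimeter_add hLe hL6
      have h4 := ncard_inter_add_ncard_inter (oddRegion σ)
      have h5 := ncard_inter_add_ncard_inter (oddRegion τ)
      have h6 := ((hτ.isOddClosed hLe).ncard_inter_oddSites_le hL hl hlM hτn).1
      have h8 := hodd _ hη
      rw [← hr] at h8
      omega
  · constructor
    · rintro ⟨hC, hn, hmin⟩
      have h1 := hmin _ (isOddCluster_rhombus hLe (by omega) hl hη₀)
        (ncard_rhombus hL hl hlM hη₀)
      have h2 := clusterPerimeter_add hLe (by omega) hC.isOddClosed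
      have h3 := clusterPerimeter_add hLe (by omega) (isOddClosed_rhombus hLe hL1 (l := l) hη₀)
      have h4 := ncard_inter_add_ncard_inter C
      have h5 := ncard_inter_add_ncard_inter (rhombus l l ((1, 0) : Site L))
      have h6 := hC.isOddClosed.ncard_inter_oddSites_le hL hl hlM hn
      have h7 := ncard_rhombus hL hl hlM hη₀
      have h8 := hodd _ hη₀
      exact h6.2 (by omega)
    · rintro ⟨η, hη, rfl⟩
      refine ⟨isOddCluster_rhombus hLe (by omega) hl hη, ncard_rhombus hL hl hlM hη,
        fun D hD hDn => ?_⟩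
      have h2 := clusterPerimeter_add hLe (by omega) hD.isOddClosed
      have h3 := clusterPerimeter_add hLe (by omega) (isOddClosed_rhombus hLe hL1 (l := l) hη)
      have h4 := ncard_inter_add_ncard_inter D
      have h5 := ncard_inter_add_ncard_inter (rhombus l l η)
      have h6 := (hD.isOddClosed.ncard_inter_oddSites_le hL hl hlM hDn).1
      have h7 := ncard_rhombus hL hl hlM hη
      have h8 := hodd _ hη
      omega

end Rhombus

theorem mainTheorem3 (L : ℕ) (hL : Even L) (hL6 : 6 ≤ L) :
    (∀ l : ℕ, 1 ≤ l → 2 * l < L → RhombusIsUniqueMinimizer L l (2 * l ^ 2 + 2 * l + 1)) ∧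
      RhombusIsUniqueMinimizer L (L / 2 - 1) (L ^ 2 / 2 - L + 1) := by
  have : NeZero L := ⟨by omega⟩
  obtain ⟨M, hM⟩ := hL
  have hLM : L = 2 * M := by omega
  refine ⟨fun l hl hlL => rhombusIsUniqueMinimizer hLM hL6 hl (by omega), ?_⟩
  obtain ⟨m, rfl⟩ : ∃ m, M = m + 1 := ⟨M - 1, by omega⟩
  have h1 : L / 2 - 1 = m := by omega
  have h2 : L ^ 2 / 2 - L + 1 = 2 * m ^ 2 + 2 * m + 1 := by
    have h3 : L ^ 2 = 2 * (2 * m ^ 2 + 2 * m + L) := by rw [hLM]; ring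
    omega
  rw [h1, h2]
  exact rhombusIsUniqueMinimizer hLM hL6 (by omega) (by omega)
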